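/- Notation. For $\tau\in\mathbb C$ with $\operatorname{Im}\tau>0$ put $q^x=e^{2\pi i\tau x}$. For $m>0$ and $k\in\mathbb R$ let $$\theta^{(\pm)}_{k,m}(\tau,z)=\sum_{j\in\mathbb Z}(\pm1)^jq^{m(j+\frac{k}{2m})^2}e^{2\pi im(j+\frac{k}{2m})z},\qquad \theta_{k,m}=\theta^{(+)}_{k,m},$$ $$\vartheta_{11}(\tau,z)=\sum_{n\in\mathbb Z}e^{\pi i(n+\frac12)^2\tau+2\pi i(n+\frac12)(z+\frac12)},\qquad \eta(\tau)=q^{1/24}\prod_{n\ge1}(1-q^n),$$ and $$\Phi^{[m,0]*}(\tau,z_1,z_2,0)=\sum_{j\in\mathbb Z}\frac{e^{2\pi imj(z_1+z_2)}q^{mj^2}}{1-e^{2\pi iz_1}q^j}+\sum_{j\in\mathbb Z}\frac{e^{-2\pi imj(z_1+z_2)}q^{mj^2}}{1-e^{-2\pi iz_2}q^j}.$$ Proposition. Let $m\in\frac12\mathbb N=\{\frac12,1,\frac32,\dots\}$, $\operatorname{Im}\tau>0$ and $z_1,z_2\in\mathbb C\setminus(\mathbb Z+\mathbb Z\tau)$.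 Put $$c_{j,k}=(-1)^jq^{(m+\frac12)(j+\frac1{4(m+1/2)})^2}q^{-\frac{k^2}{4m}}e^{2\pi im(j+\frac1{4(m+1/2)})(z_1-z_2)}e^{-\pi ik(z_1-z_2)},$$ $$E=i\,\eta(\tau)^3\left\{-\frac{\theta^{(-)}_{-\frac12,m+\frac12}\left(\tau,z_1+z_2+\frac{z_1-z_2}{2m+1}\right)}{\vartheta_{11}(\tau,z_1)}+\frac{\theta^{(-)}_{\frac12,m+\frac12}\left(\tau,z_1+z_2-\frac{z_1-z_2}{2m+1}\right)}{\vartheta_{11}(\tau,z_2)}\right\}.$$ Then the two series defining $\Phi^{[m,0]*}(\tau,z_1,z_2,0)$ and all the double series below (in (b), each over $(j,r)$ with terms the inner finite sums over $s$) converge absolutely, $\vartheta_{11}(\tau,z_1)$ and $\vartheta_{11}(\tau,z_2)$ are nonzero, and the following two formulas hold. (a) $$\theta^{(-)}_{\frac12,m+\frac12}\Big(\tau,\tfrac{m(z_1-z_2)}{m+\frac12}\Big)\,\Phi^{[m,0]*}(\tau,z_1,z_2,0)=-\Bigg[\sum_{\substack{j,k\in\mathbb Z\\0<k\le2mj}}-\sum_{\substack{j,k\in\mathbb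 Z\\2mj<k\le0}}\Bigg]c_{j,k}\,[\theta_{k,m}+\theta_{-k,m}](\tau,z_1+z_2)+E.$$ (b) $$\begin{aligned}\theta^{(-)}_{\frac12,m+\frac12}\Big(\tau,\tfrac{m(z_1-z_2)}{m+\frac12}\Big)\,\Phi^{[m,0]*}(\tau,z_1,z_2,0)=E&-\Bigg[\sum_{\substack{j,r\in\mathbb Z\\0<r\le j}}-\sum_{\substack{j,r\in\mathbb Z\\j<r\le0}}\Bigg]\sum_{\substack{s\in\mathbb Z\\0\le s\le m}}c_{j,2mr-s}\,[\theta_{s,m}+\theta_{-s,m}](\tau,z_1+z_2)\\&-\Bigg[\sum_{\substack{j,r\in\mathbb Z\\0\le r<j}}-\sum_{\substack{j,r\in\mathbb Z\\j\le r<0}}\Bigg]\sum_{\substack{s\in\mathbb Z\\0<s<m}}c_{j,2mr+s}\,[\theta_{s,m}+\theta_{-s,m}](\tau,z_1+z_2).\end{aligned}$$ -/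

import Mathlib

noncomputable section

namespace MockTheta

/-- `q ^ x = e ^ (2 π i τ x)`, where `q = e ^ (2 π i τ)`. -/
def qPow (τ x : ℂ) : ℂ := Complex.exp (2 * Real.pi * Complex.I * τ * x)

/-- The Jacobi theta function of degree `m` with a sign `ε = ±1`,
`θ^{(±)}_{k,m}(τ,z) = ∑_{j ∈ ℤ} (±1)^j q^{m (j + k/2m)^2} e^{2 π i m (j + k/2m) z}`. -/
def thetaSgn (ε : ℤ) (k m : ℝ) (τ z : ℂ) : ℂ :=
  ∑' j : ℤ, (ε : ℂ) ^ j * qPow τ (m * (j + k / (2 * m)) ^ 2) *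
    Complex.exp (2 * Real.pi * Complex.I * m * (j + k / (2 * m)) * z)

/-- `[θ_{k,m} + θ_{-k,m}](τ,z)`, where `θ_{k,m} = θ^{(+)}_{k,m}`. -/
def thetaSymm (k m : ℝ) (τ z : ℂ) : ℂ :=
  thetaSgn 1 k m τ z + thetaSgn 1 (-k) m τ z

/-- Mumford's theta function
`ϑ₁₁(τ,z) = ∑_{n ∈ ℤ} e^{π i (n + 1/2)^2 τ + 2 π i (n + 1/2) (z + 1/2)}`. -/
def vartheta11 (τ z : ℂ) : ℂ :=
  ∑' n : ℤ, Complex.exp (Real.pi * Complex.I * (n + 1 / 2) ^ 2 * τ +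
    2 * Real.pi * Complex.I * (n + 1 / 2) * (z + 1 / 2))

/-- The `j`-th term of the series of `Φ^{(±)[m,s]}_1(τ,z₁,z₂,0)`. -/
def Phi1Term (ε : ℤ) (m s : ℝ) (τ z₁ z₂ : ℂ) (j : ℤ) : ℂ :=
  (ε : ℂ) ^ j * Complex.exp (2 * Real.pi * Complex.I * m * j * (z₁ + z₂) +
      2 * Real.pi * Complex.I * s * z₁) * qPow τ (m * j ^ 2 + s * j) /
    (1 - Complex.exp (2 * Real.pi * Complex.I * z₁) * qPow τ j)

/-- The `j`-th term of the series of `Φ^{(±)[m,s]}_2(τ,z₁,z₂,0)`. -/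
def Phi2Term (ε : ℤ) (m s : ℝ) (τ z₁ z₂ : ℂ) (j : ℤ) : ℂ :=
  (ε : ℂ) ^ j * Complex.exp (-(2 * Real.pi * Complex.I * m * j * (z₁ + z₂)) -
      2 * Real.pi * Complex.I * s * z₂) * qPow τ (m * j ^ 2 + s * j) /
    (1 - Complex.exp (-(2 * Real.pi * Complex.I * z₂)) * qPow τ j)

/-- `Φ^{(±)[m,s]}_1(τ,z₁,z₂,t)`. -/
def Phi1 (ε : ℤ) (m s : ℝ) (τ z₁ z₂ t : ℂ) : ℂ :=
  Complex.exp (-(2 * Real.pi * Complex.I * m * t)) * ∑' j : ℤ, Phi1Term ε m s τ z₁ z₂ j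

/-- `Φ^{(±)[m,s]}_2(τ,z₁,z₂,t)`. -/
def Phi2 (ε : ℤ) (m s : ℝ) (τ z₁ z₂ t : ℂ) : ℂ :=
  Complex.exp (-(2 * Real.pi * Complex.I * m * t)) * ∑' j : ℤ, Phi2Term ε m s τ z₁ z₂ j

/-- `Φ^{(±)[m,s]*} = Φ^{(±)[m,s]}_1 + Φ^{(±)[m,s]}_2`. -/
def PhiStar (ε : ℤ) (m s : ℝ) (τ z₁ z₂ t : ℂ) : ℂ :=
  Phi1 ε m s τ z₁ z₂ t + Phi2 ε m s τ z₁ z₂ t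

/-- `(-1)^j q^{(m+1/2)(j + 1/(4(m+1/2)))^2} q^{-k^2/4m}
e^{2 π i m (j + 1/(4(m+1/2))) w} e^{-π i k w}`. -/
def coeff (m : ℝ) (τ w : ℂ) (j : ℤ) (k : ℝ) : ℂ :=
  (-1 : ℂ) ^ j * qPow τ ((m + 1 / 2) * (j + 1 / (4 * (m + 1 / 2))) ^ 2) *
    qPow τ (-(k ^ 2 / (4 * m))) *
    Complex.exp (2 * Real.pi * Complex.I * m * (j + 1 / (4 * (m + 1 / 2))) * w) *
    Complex.exp (-(Real.pi * Complex.I * k * w))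

/-- The summand of the indefinite double sum over `p = (j,k)`. -/
def doubleTerm (m : ℝ) (τ z₁ z₂ : ℂ) (p : ℤ × ℤ) : ℂ :=
  coeff m τ (z₁ - z₂) p.1 p.2 * thetaSymm p.2 m τ (z₁ + z₂)

/-- The summand at `p = (j,r)` of the first regrouped sum, an inner sum over the
integers `0 ≤ s ≤ m`. -/
def closedTerm (m : ℝ) (τ z₁ z₂ : ℂ) (p : ℤ × ℤ) : ℂ :=
  ∑ s ∈ Finset.Icc (0 : ℤ) ⌊m⌋,
    coeff m τ (z₁ - z₂) p.1 (2 * m * p.2 - s) * thetaSymm s m τ (z₁ + z₂)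

/-- The summand at `p = (j,r)` of the second regrouped sum, an inner sum over the
integers `0 < s < m`. -/
def openTerm (m : ℝ) (τ z₁ z₂ : ℂ) (p : ℤ × ℤ) : ℂ :=
  ∑ s ∈ Finset.Ioo (0 : ℤ) ⌈m⌉,
    coeff m τ (z₁ - z₂) p.1 (2 * m * p.2 + s) * thetaSymm s m τ (z₁ + z₂)

/-- The pairs `(j,k)` with `0 < k ≤ 2mj`. -/
def conePos (m : ℝ) : Set (ℤ × ℤ) := {p | 0 < p.2 ∧ (p.2 : ℝ) ≤ 2 * m * p.1}

/-- The pairs `(j,k)` with `2mj < k ≤ 0`. -/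
def coneNeg (m : ℝ) : Set (ℤ × ℤ) := {p | 2 * m * p.1 < (p.2 : ℝ) ∧ p.2 ≤ 0}

/-- The difference `∑_{p ∈ A} f p - ∑_{p ∈ B} f p`. -/
def diffSum (A B : Set (ℤ × ℤ)) (f : ℤ × ℤ → ℂ) : ℂ :=
  (∑' p : A, f p) - ∑' p : B, f p

/-- The term of the formula made of `η` and of quotients of theta functions. -/
def etaTerm (m : ℝ) (τ z₁ z₂ : ℂ) : ℂ :=
  Complex.I * ModularForm.eta τ ^ 3 *
    (-(thetaSgn (-1) (-1 / 2) (m + 1 / 2) τ (z₁ + z₂ + (z₁ - z₂) / (2 * m + 1)) /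
        vartheta11 τ z₁) +
      thetaSgn (-1) (1 / 2) (m + 1 / 2) τ (z₁ + z₂ - (z₁ - z₂) / (2 * m + 1)) /
        vartheta11 τ z₂)

end MockTheta

end

open MockTheta

noncomputable section

namespace MockTheta

open Filter Topology

/-! Φ is a sum of two Appell series A(Z,z) = ∑_l e(mlZ) q^{ml²} / (1 - y_l), y_l = e(z+lτ), taken at
(Z,z) = (z₁+z₂, z₁) and (-(z₁+z₂), -z₂). Both pairs have 2z - Z = z₁ - z₂, so one prefactor ∑_j
c_{j,0} serves both.

In the j-th product, write 1/(1-y) = y^{-2mj}/(1-y) - ∑_{0<k≤2mj} y^{-k}, the finite sum being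
signed when j < 0. Summed over l, the finite part gives c_{j,k} θ_{-k,m}(Z); the two series thus
supply θ_{-k,m} and θ_{k,m} at z₁+z₂. The exponent 2mj is the one for which, after l ↦ l+j, the rest
becomes (-1)^j q^{j(j+1)/2} / (1 - y_{l+j}) times e(mlZ) q^{ml²} (`coeff_mul_tsum_appellTerm`). Its
sum over j is the partial fraction series of 1/ϑ₁₁ at z+lτ; quasi-periodicity brings it back to z,
and the sum over l is then a theta series of degree m+1/2. This is E (`tsum_apTerm_mul`).

The partial fraction expansion is proved on Fourier coefficients (`th_mul_tsum_apTerm`): theta times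
the series has only a constant term, the sum of all partial sums D_n of the theta coefficients.
Jacobi's identity, from a finite triple product, evaluates it as ∏(1-q^i)³ (`tsum_thPartial`). As
this is nonzero, ϑ₁₁ does not vanish off the lattice.

Formula (b) is (a) with k written as 2mr-s or 2mr+s: θ_{k,m} + θ_{-k,m} is even in k with period 2m,
and the cone conditions become conditions on (j,r) alone. -/

/-- `e x = exp (2 π i x)`. -/
def e (x : ℂ) : ℂ := Complex.exp (2 * Real.pi * Complex.I * x)

/-! ### Exponentials, signs and Gaussian series -/

lemma e_add (x y : ℂ) : e (x + y) = e x * e y := by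
  simp only [e, mul_add, Complex.exp_add]

lemma e_zero : e 0 = 1 := by simp [e]

lemma e_ne_zero (x : ℂ) : e x ≠ 0 := Complex.exp_ne_zero _

lemma e_neg (x : ℂ) : e (-x) = (e x)⁻¹ := by
  simp only [e, mul_neg, Complex.exp_neg]

lemma e_zpow (x : ℂ) (n : ℤ) : e x ^ n = e (n * x) := by
  simp only [e, ← Complex.exp_int_mul]; ring_nf

lemma e_pow (x : ℂ) (n : ℕ) : e x ^ n = e (n * x) := by
  simp only [e, ← Complex.exp_nat_mul]; ring_nf

lemma e_eq_one_iff (x : ℂ) : e x = 1 ↔ ∃ n : ℤ, x = n := by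
  rw [e, Complex.exp_eq_one_iff]
  refine exists_congr fun n => ⟨fun h => ?_, fun h => by rw [h]; ring⟩
  refine mul_left_cancel₀ Complex.two_pi_I_ne_zero (h.trans (by ring))

lemma norm_e (x : ℂ) : ‖e x‖ = Real.exp (-(2 * Real.pi * x.im)) := by
  rw [e, Complex.norm_exp]
  congr 1
  simp [Complex.mul_re, Complex.mul_im]

lemma qPow_eq_e (τ x : ℂ) : qPow τ x = e (τ * x) := by
  simp only [qPow, e, mul_assoc]

lemma norm_neg_one_zpow (n : ℤ) : ‖(-1 : ℂ) ^ n‖ = 1 := by simp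

lemma neg_one_zpow_mul_self (n : ℤ) : (-1 : ℂ) ^ n * (-1 : ℂ) ^ n = 1 := by
  rw [← mul_zpow]; simp

lemma neg_one_zpow_neg (n : ℤ) : (-1 : ℂ) ^ (-n) = (-1 : ℂ) ^ n := by
  rw [zpow_neg, ← inv_zpow]; norm_num

lemma neg_one_zpow_add (m n : ℤ) : (-1 : ℂ) ^ (m + n) = (-1 : ℂ) ^ m * (-1 : ℂ) ^ n :=
  zpow_add₀ (by norm_num) m n

lemma summable_exp_quadratic {a : ℝ} (ha : 0 < a) (b c : ℝ) :
    Summable fun j : ℤ => Real.exp (-(a * j ^ 2) + b * j + c) := by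
  have h := ((summable_jacobiTheta₂_term_iff (-(b / (2 * Real.pi) : ℝ) * Complex.I)
    ((a / Real.pi : ℝ) * Complex.I)).2 (by
      simpa [-Complex.ofReal_div] using div_pos ha Real.pi_pos)).norm.mul_right (Real.exp c)
  refine h.congr fun j => ?_
  rw [norm_jacobiTheta₂_term, ← Real.exp_add]
  congr 1
  have := Real.pi_ne_zero
  simp [-Complex.ofReal_div]
  field_simp

lemma norm_e_quadratic (a b c : ℂ) (x : ℝ) :
    ‖e (a * x ^ 2 + b * x + c)‖ =
      Real.exp (-(2 * Real.pi * a.im * x ^ 2) + -(2 * Real.pi * b.im) * x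
        + -(2 * Real.pi * c.im)) := by
  rw [norm_e]
  congr 1
  have : a * (x : ℂ) ^ 2 + b * x + c = a * ((x ^ 2 : ℝ) : ℂ) + b * x + c := by push_cast; ring
  rw [this]
  simp only [Complex.add_im, Complex.mul_im, Complex.ofReal_re, Complex.ofReal_im]
  ring

lemma summable_norm_e_quadratic {a : ℂ} (ha : 0 < a.im) (b c : ℂ) :
    Summable fun j : ℤ => ‖e (a * j ^ 2 + b * j + c)‖ := by
  have h := summable_exp_quadratic (a := 2 * Real.pi * a.im) (by positivity)
    (-(2 * Real.pi * b.im)) (-(2 * Real.pi * c.im))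
  refine h.congr fun j => ?_
  have := norm_e_quadratic a b c j
  push_cast at this
  rw [this]

lemma summable_norm_of_eq_e_quadratic {a : ℂ} (ha : 0 < a.im) (b c : ℂ) {f : ℤ → ℂ}
    (hf : ∀ j : ℤ, ‖f j‖ = ‖e (a * j ^ 2 + b * j + c)‖) : Summable fun j => ‖f j‖ :=
  (summable_norm_e_quadratic ha b c).congr fun j => (hf j).symm

/-! ### The theta series and the partial sums of its coefficients -/

/-- The coefficients of the theta series. -/
def thCoeff (τ : ℂ) (k : ℤ) : ℂ := (-1 : ℂ) ^ k * e (τ * (k * (k - 1) / 2))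

lemma norm_thCoeff (τ : ℂ) (k : ℤ) : ‖thCoeff τ k‖ = ‖e (τ * (k * (k - 1) / 2))‖ := by
  rw [thCoeff, norm_mul, norm_neg_one_zpow, one_mul]

lemma thCoeff_one_sub (τ : ℂ) (k : ℤ) : thCoeff τ (1 - k) = -thCoeff τ k := by
  rw [thCoeff, thCoeff, sub_eq_add_neg, neg_one_zpow_add, neg_one_zpow_neg, zpow_one]
  push_cast
  rw [show τ * ((1 + -(k : ℂ)) * (1 + -k - 1) / 2) = τ * (k * (k - 1) / 2) by ring]
  ring

/-- The theta series in multiplicative normalisation. -/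
def th (τ z : ℂ) : ℂ := ∑' k : ℤ, thCoeff τ k * e (k * z)

lemma summable_thCoeff_mul {τ : ℂ} (hτ : 0 < τ.im) (z : ℂ) :
    Summable fun k : ℤ => thCoeff τ k * e (k * z) := by
  refine Summable.of_norm (summable_norm_of_eq_e_quadratic (a := τ / 2) (by simpa using hτ)
    (z - τ / 2) 0 fun j => ?_)
  rw [norm_mul, norm_thCoeff, ← norm_mul, ← e_add]
  congr 2
  ring

lemma summable_thCoeff {τ : ℂ} (hτ : 0 < τ.im) : Summable (thCoeff τ) := by
  simpa [e_zero] using summable_thCoeff_mul hτ 0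

/-- The reflection k ↦ 1-k reverses the sign of every coefficient. This is the zero of theta at z =
0. -/
lemma tsum_thCoeff (τ : ℂ) : ∑' k, thCoeff τ k = 0 := by
  have h : ∑' k, thCoeff τ k = -∑' k, thCoeff τ k := by
    conv_lhs => rw [← (Equiv.subLeft (1 : ℤ)).tsum_eq]
    rw [← tsum_neg]
    exact tsum_congr fun k => by simp [thCoeff_one_sub]
  exact self_eq_neg.1 h

/-- The partial sums of the coefficients of the theta series. -/
def thPartial (τ : ℂ) (n : ℤ) : ℂ := ∑' i : ℕ, thCoeff τ (n - i)

lemma summable_thCoeff_sub {τ : ℂ} (hτ : 0 < τ.im) (n : ℤ) :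
    Summable fun i : ℕ => thCoeff τ (n - i) :=
  (summable_thCoeff hτ).comp_injective fun i j h => by simpa using h

lemma thPartial_sub {τ : ℂ} (hτ : 0 < τ.im) (n : ℤ) :
    thPartial τ n - thPartial τ (n - 1) = thCoeff τ n := by
  rw [thPartial, (summable_thCoeff_sub hτ n).tsum_eq_zero_add, thPartial]
  have : ∀ i : ℕ, thCoeff τ (n - ((i + 1 : ℕ) : ℤ)) = thCoeff τ (n - 1 - i) := fun i => by
    congr 1; push_cast; ring
  simp only [this]
  simp

/-- As the total is zero, the partial sum up to n is minus the tail beyond n, and k ↦ 1-k carries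
that tail to minus the partial sum up to -n. -/
lemma thPartial_neg {τ : ℂ} (hτ : 0 < τ.im) (n : ℤ) : thPartial τ (-n) = thPartial τ n := by
  have h1 : ∀ i : ℕ, thCoeff τ ((i : ℤ) + (n + 1)) = -thCoeff τ (-n - i) := fun i => by
    rw [← thCoeff_one_sub]; congr 1; ring
  have h2 : ∀ i : ℕ, thCoeff τ (-((i : ℤ) + 1) + (n + 1)) = thCoeff τ (n - i) :=
    fun i => by congr 1; ring
  have h := tsum_of_nat_of_neg_add_one (f := fun k : ℤ => thCoeff τ (k + (n + 1)))
    (by simpa only [h1] using (summable_thCoeff_sub hτ (-n)).neg)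
    (by simpa only [h2] using summable_thCoeff_sub hτ n)
  have h0 : ∑' k : ℤ, thCoeff τ (k + (n + 1)) = 0 :=
    ((Equiv.addRight (n + 1)).tsum_eq (thCoeff τ)).trans (tsum_thCoeff τ)
  rw [h0] at h
  simp only [h1, h2, tsum_neg] at h
  rw [thPartial, thPartial]
  linear_combination h

/-- For n ≤ 0 ≤ i, (n-i)(n-i-1)/2 exceeds n²/2 + i²/2 + i/2 by -ni - n/2 ≥ 0. Evenness in n then
gives Gaussian decay on both sides. -/
lemma norm_thPartial_le_of_nonpos {τ : ℂ} (hτ : 0 < τ.im) {n : ℤ} (hn : n ≤ 0) :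
    ‖thPartial τ n‖ ≤
      (∑' i : ℤ, ‖e (τ / 2 * i ^ 2 + τ / 2 * i + 0)‖) * ‖e (τ * (n ^ 2 / 2))‖ := by
  have hs := summable_norm_e_quadratic (a := τ / 2) (by simpa using hτ) (τ / 2) 0
  have hs' : Summable fun i : ℕ => ‖e (τ / 2 * (i : ℤ) ^ 2 + τ / 2 * (i : ℤ) + 0)‖ :=
    hs.comp_injective Nat.cast_injective
  have hle : ∀ i : ℕ, ‖thCoeff τ (n - i)‖ ≤
      ‖e (τ / 2 * (i : ℤ) ^ 2 + τ / 2 * (i : ℤ) + 0)‖ * ‖e (τ * (n ^ 2 / 2))‖ := fun i => by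
    rw [norm_thCoeff, ← norm_mul, ← e_add, norm_e, norm_e, Real.exp_le_exp]
    have hr : ∀ x : ℝ, (τ * (x : ℂ)).im = τ.im * x := fun x => by simp
    have e1 : τ * (((n - i : ℤ) : ℂ) * ((n - i : ℤ) - 1) / 2) =
      τ * (((n - i : ℝ) * ((n - i) - 1) / 2 : ℝ) : ℂ) := by push_cast; ring
    have e2 : τ / 2 * ((i : ℤ) : ℂ) ^ 2 + τ / 2 * ((i : ℤ) : ℂ) + 0 + τ * ((n : ℂ) ^ 2 / 2) =
      τ * (((i : ℝ) ^ 2 / 2 + i / 2 + n ^ 2 / 2 : ℝ) : ℂ) := by push_cast; ring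
    rw [e1, e2, hr, hr]
    have hn' : (n : ℝ) ≤ 0 := by exact_mod_cast hn
    have hi : (0 : ℝ) ≤ i := Nat.cast_nonneg i
    have : ((i : ℝ) ^ 2 / 2 + i / 2 + n ^ 2 / 2) ≤ ((n - i : ℝ) * ((n - i) - 1) / 2) := by
      nlinarith [mul_nonneg hi (neg_nonneg.2 hn')]
    have := mul_le_mul_of_nonneg_left this hτ.le
    nlinarith [Real.pi_pos, mul_le_mul_of_nonneg_left this Real.pi_pos.le]
  have hs2 := hs'.mul_right ‖e (τ * (n ^ 2 / 2))‖
  calc ‖thPartial τ n‖ ≤ ∑' i : ℕ, ‖thCoeff τ (n - i)‖ :=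
        norm_tsum_le_tsum_norm (Summable.of_nonneg_of_le (fun _ => norm_nonneg _) hle hs2)
    _ ≤ ∑' i : ℕ, ‖e (τ / 2 * (i : ℤ) ^ 2 + τ / 2 * (i : ℤ) + 0)‖ * ‖e (τ * (n ^ 2 / 2))‖ :=
        (Summable.of_nonneg_of_le (fun _ => norm_nonneg _) hle hs2).tsum_le_tsum hle hs2
    _ ≤ _ := by
        rw [tsum_mul_right]
        refine mul_le_mul_of_nonneg_right ?_ (norm_nonneg _)
        exact tsum_comp_le_tsum_of_inj hs (fun _ => norm_nonneg _)
          (i := fun i : ℕ => (i : ℤ)) Nat.cast_injective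

lemma exists_norm_thPartial_le {τ : ℂ} (hτ : 0 < τ.im) :
    ∃ C : ℝ, ∀ n : ℤ, ‖thPartial τ n‖ ≤ C * ‖e (τ * (n ^ 2 / 2))‖ := by
  refine ⟨∑' i : ℤ, ‖e (τ / 2 * i ^ 2 + τ / 2 * i + 0)‖, fun n => ?_⟩
  rcases le_total n 0 with hn | hn
  · exact norm_thPartial_le_of_nonpos hτ hn
  · rw [← thPartial_neg hτ]
    simpa using norm_thPartial_le_of_nonpos hτ (neg_nonpos.2 hn)

lemma summable_norm_thPartial_mul {τ : ℂ} (hτ : 0 < τ.im) (z : ℂ) :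
    Summable fun n : ℤ => ‖thPartial τ n * e (n * z)‖ := by
  obtain ⟨C, hC⟩ := exists_norm_thPartial_le hτ
  refine Summable.of_nonneg_of_le (fun _ => norm_nonneg _) (fun n => ?_)
    ((summable_norm_e_quadratic (a := τ / 2) (by simpa using hτ) z 0).mul_left C)
  rw [norm_mul]
  refine (mul_le_mul_of_nonneg_right (hC n) (norm_nonneg _)).trans_eq ?_
  rw [mul_assoc, ← norm_mul, ← e_add]
  congr 3
  ring

/-- Summation by parts: the zero of theta at z = 0 is divided out explicitly, leaving the partial
sums as Fourier coefficients. -/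
lemma th_eq_one_sub_mul {τ : ℂ} (hτ : 0 < τ.im) (z : ℂ) :
    th τ z = (1 - e z) * ∑' n : ℤ, thPartial τ n * e (n * z) := by
  have hs := (summable_norm_thPartial_mul hτ z).of_norm
  have hs' : Summable fun n : ℤ => thPartial τ (n - 1) * e ((n - 1 : ℤ) * z) :=
    (Equiv.summable_iff (Equiv.subRight (1 : ℤ))).2 hs
  have h1 : ∑' n : ℤ, thPartial τ n * e (n * z) =
      ∑' n : ℤ, thPartial τ (n - 1) * e ((n - 1 : ℤ) * z) :=
    ((Equiv.subRight (1 : ℤ)).tsum_eq fun n : ℤ => thPartial τ n * e (n * z)).symm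
  rw [sub_mul, one_mul]
  conv_rhs => rw [h1]
  conv_rhs => arg 1; rw [← h1]
  rw [← tsum_mul_left, ← hs.tsum_sub (hs'.mul_left _), th]
  refine tsum_congr fun n => ?_
  rw [← thPartial_sub hτ n, mul_left_comm, ← e_add]
  push_cast
  rw [show z + ((n : ℂ) - 1) * z = n * z by ring]
  ring

lemma th_add_mul (τ z : ℂ) (j : ℤ) :
    th τ (z + j * τ) = (-1) ^ j * e (-(j * z) - τ * (j * (j - 1) / 2)) * th τ z := by
  rw [th, th, ← tsum_mul_left, ← (Equiv.subRight j).tsum_eq]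
  refine tsum_congr fun k => ?_
  simp only [Equiv.subRight_apply, thCoeff]
  rw [sub_eq_add_neg k j, neg_one_zpow_add, neg_one_zpow_neg]
  have : ∀ a b c d f g : ℂ, e b * e c = e f * (e g * e d) →
      a * e b * e c = e f * (a * e g * e d) := fun a b c d f g h => by
    linear_combination a * h
  have h2 := this ((-1) ^ k) (τ * (((k + -j : ℤ) : ℂ) * ((k + -j : ℤ) - 1) / 2))
    ((k + -j : ℤ) * (z + j * τ)) (k * z) (-(j * z) - τ * (j * (j - 1) / 2))
    (τ * (k * (k - 1) / 2)) (by
      simp only [← e_add]; congr 1; push_cast; ring)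
  linear_combination (-1) ^ j * h2

/-! ### Partial fractions for the inverse of theta -/

/-- The terms of the partial fraction expansion of the inverse of the theta series. -/
def apTerm (τ z : ℂ) (j : ℤ) : ℂ := (-1) ^ j * e (τ * (j * (j + 1) / 2)) / (1 - e (z + j * τ))

/-- Quasi-periodicity moves theta to z+jτ, where its factor 1 - e(z+jτ) cancels the denominator;
shifting n by j restores the frequency e(nz). -/
lemma th_mul_apTerm {τ : ℂ} (hτ : 0 < τ.im) (z : ℂ) (j : ℤ) (h : e (z + j * τ) ≠ 1) :
    th τ z * apTerm τ z j =
      ∑' n : ℤ, e (τ * (j * n)) * thPartial τ (n - j) * e (n * z) := by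
  have h1 := th_eq_one_sub_mul hτ (z + j * τ)
  rw [th_add_mul] at h1
  have h2 : th τ z * apTerm τ z j = e (τ * j ^ 2) * e (j * z) *
      ∑' n : ℤ, thPartial τ n * e (n * (z + j * τ)) := by
    have hne : 1 - e (z + j * τ) ≠ 0 := sub_ne_zero.2 (Ne.symm h)
    rw [apTerm, mul_div_assoc', div_eq_iff hne]
    have h3 : e (τ * (j * (j + 1) / 2)) = e (τ * j ^ 2) * e (j * z) *
        e (-(j * z) - τ * (j * (j - 1) / 2)) := by
      simp only [← e_add]; congr 1; ring
    rw [h3]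
    linear_combination e (τ * j ^ 2) * e (j * z) * h1
  rw [h2, ← tsum_mul_left, ← (Equiv.subRight j).tsum_eq]
  refine tsum_congr fun n => ?_
  simp only [Equiv.subRight_apply]
  have : e (τ * j ^ 2) * e (j * z) * e ((n - j : ℤ) * (z + j * τ)) = e (τ * (j * n)) * e (n * z) := by
    simp only [← e_add]; congr 1; push_cast; ring
  linear_combination thPartial τ (n - j) * this

/-- The cross term of q^{(n-j)²/2} cancels q^{jn}, leaving a product of two Gaussian series. This
licenses exchanging the sums over j and n. -/
lemma summable_apTerm_expansion {τ : ℂ} (hτ : 0 < τ.im) (z : ℂ) :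
    Summable fun p : ℤ × ℤ => e (τ * (p.1 * p.2)) * thPartial τ (p.2 - p.1) * e (p.2 * z) := by
  obtain ⟨C, hC⟩ := exists_norm_thPartial_le hτ
  have hτ' : 0 < (τ / 2).im := by simpa using hτ
  have hs := ((summable_norm_e_quadratic hτ' 0 0).mul_of_nonneg
    (summable_norm_e_quadratic hτ' z 0) (fun _ => norm_nonneg _) (fun _ => norm_nonneg _)).mul_left C
  refine Summable.of_norm_bounded hs fun p => ?_
  rw [norm_mul, norm_mul]
  have h := hC (p.2 - p.1)
  calc _ ≤ ‖e (τ * (p.1 * p.2))‖ * (C * ‖e (τ * ((p.2 - p.1 : ℤ) ^ 2 / 2))‖) * ‖e (p.2 * z)‖ := by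
        gcongr
    _ = C * ‖e (τ * (p.1 * p.2)) * e (τ * ((p.2 - p.1 : ℤ) ^ 2 / 2)) * e (p.2 * z)‖ := by
        rw [norm_mul, norm_mul]; ring
    _ = _ := by
        rw [← norm_mul, ← e_add, ← e_add, ← e_add]
        congr 3
        push_cast
        ring

lemma e_int_mul_ne_one {τ : ℂ} (hτ : 0 < τ.im) {n : ℤ} (hn : n ≠ 0) : e (n * τ) ≠ 1 := by
  rw [Ne, e_eq_one_iff]
  rintro ⟨k, hk⟩
  have := congrArg Complex.im hk
  simp only [Complex.mul_im, Complex.intCast_re, Complex.intCast_im, zero_mul, add_zero] at this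
  rcases mul_eq_zero.1 this with h | h
  · exact hn (by exact_mod_cast h)
  · exact hτ.ne' h

lemma summable_e_mul_thPartial {τ : ℂ} (hτ : 0 < τ.im) (n : ℤ) :
    Summable fun j : ℤ => e (τ * (j * n)) * thPartial τ (n - j) := by
  have := (summable_apTerm_expansion hτ 0).comp_injective
    (i := fun j : ℤ => (j, n)) (fun a b h => (Prod.ext_iff.1 h).1)
  simpa [Function.comp_def, e_zero] using this

/-- Shifting j by one gives S = q^n (S - T), where T is a multiple of the vanishing sum of theta
coefficients. Hence (1 - q^n) S = 0. -/
lemma tsum_e_mul_thPartial {τ : ℂ} (hτ : 0 < τ.im) {n : ℤ} (hn : n ≠ 0) :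
    ∑' j : ℤ, e (τ * (j * n)) * thPartial τ (n - j) = 0 := by
  have hs := summable_e_mul_thPartial hτ n
  have ht : Summable fun j : ℤ => e (τ * (j * n)) * thCoeff τ (n - j) := by
    refine Summable.of_norm (summable_norm_of_eq_e_quadratic (a := τ / 2) (by simpa using hτ)
      (τ / 2) (τ * (n * (n - 1) / 2)) fun j => ?_)
    rw [norm_mul, norm_thCoeff, ← norm_mul, ← e_add]
    congr 2
    push_cast
    ring
  have h0 : ∑' j : ℤ, e (τ * (j * n)) * thCoeff τ (n - j) = 0 := by
    have : ∀ j : ℤ, e (τ * (j * n)) * thCoeff τ (n - j) =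
        (-1) ^ n * e (τ * (n * (n - 1) / 2)) * thCoeff τ (-j) := fun j => by
      rw [thCoeff, thCoeff, sub_eq_add_neg, neg_one_zpow_add, neg_one_zpow_neg]
      have : e (τ * (j * n)) * e (τ * (((n + -j : ℤ) : ℂ) * ((n + -j : ℤ) - 1) / 2)) =
          e (τ * (n * (n - 1) / 2)) * e (τ * (((-j : ℤ) : ℂ) * ((-j : ℤ) - 1) / 2)) := by
        simp only [← e_add]; congr 1; push_cast; ring
      linear_combination (-1) ^ n * (-1) ^ j * this
    simp only [this]
    have h0 : ∑' j : ℤ, thCoeff τ (-j) = 0 :=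
      ((Equiv.neg ℤ).tsum_eq (thCoeff τ)).trans (tsum_thCoeff τ)
    rw [tsum_mul_left, h0, mul_zero]
  have h1 : ∑' j : ℤ, e (τ * (j * n)) * thPartial τ (n - j) =
      e (n * τ) * (∑' j : ℤ, e (τ * (j * n)) * thPartial τ (n - j) -
        ∑' j : ℤ, e (τ * (j * n)) * thCoeff τ (n - j)) := by
    conv_lhs => rw [← (Equiv.addRight (1 : ℤ)).tsum_eq]
    rw [← hs.tsum_sub ht, ← tsum_mul_left]
    refine tsum_congr fun j => ?_
    rw [← thPartial_sub hτ (n - j)]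
    simp only [Equiv.coe_addRight]
    rw [show n - (j + 1) = n - j - 1 by ring,
      show τ * (((j + 1 : ℤ) : ℂ) * n) = n * τ + τ * (j * n) by push_cast; ring, e_add]
    ring
  rw [h0, sub_zero] at h1
  have h2 : (1 - e (n * τ)) * ∑' j : ℤ, e (τ * (j * n)) * thPartial τ (n - j) = 0 := by
    linear_combination h1
  exact (mul_eq_zero.1 h2).resolve_left (sub_ne_zero.2 (e_int_mul_ne_one hτ hn).symm)

/-- Partial fraction expansion of the inverse of the theta series. -/
theorem th_mul_tsum_apTerm {τ : ℂ} (hτ : 0 < τ.im) {z : ℂ} (h : ∀ j : ℤ, e (z + j * τ) ≠ 1) :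
    th τ z * ∑' j : ℤ, apTerm τ z j = ∑' n, thPartial τ n := by
  have hs := summable_apTerm_expansion hτ z
  rw [← tsum_mul_left]
  simp only [th_mul_apTerm hτ z _ (h _)]
  have hc := Summable.tsum_comm
    (f := fun j n : ℤ => e (τ * (j * n)) * thPartial τ (n - j) * e (n * z)) hs
  rw [← hc, tsum_eq_single 0]
  · simp only [Int.cast_zero, mul_zero, zero_mul, e_zero, one_mul, mul_one, zero_sub,
      thPartial_neg hτ]
  · intro n hn
    rw [tsum_mul_right, tsum_e_mul_thPartial hτ hn, zero_mul]

/-! ### The finite triple product and Jacobi's identity -/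

/-- The finite product `∏_{i=1}^n (1 - q^i)`. -/
def qPoch (τ : ℂ) (n : ℕ) : ℂ := ∏ i ∈ Finset.range n, (1 - e ((i + 1 : ℕ) * τ))

/-- The infinite product `∏_{i≥1} (1 - q^i)`. -/
def qPochInf (τ : ℂ) : ℂ := ∏' n : ℕ, (1 - ModularForm.eta_q n τ)

lemma qPoch_succ (τ : ℂ) (n : ℕ) :
    qPoch τ (n + 1) = qPoch τ n * (1 - e ((n + 1 : ℕ) * τ)) := Finset.prod_range_succ _ _

lemma qPoch_ne_zero {τ : ℂ} (hτ : 0 < τ.im) (n : ℕ) : qPoch τ n ≠ 0 :=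
  Finset.prod_ne_zero_iff.2 fun i _ => sub_ne_zero.2 (by
    simpa using (e_int_mul_ne_one hτ (n := (i + 1 : ℕ)) (by positivity)).symm)

lemma norm_e_lt_one {τ : ℂ} (hτ : 0 < τ.im) : ‖e τ‖ < 1 := by
  rw [norm_e, Real.exp_lt_one_iff]
  have := Real.pi_pos
  have : 0 < 2 * Real.pi * τ.im := by positivity
  linarith

lemma eta_q_eq_e (τ : ℂ) (n : ℕ) : ModularForm.eta_q n τ = e ((n + 1 : ℕ) * τ) := by
  rw [ModularForm.eta_q_eq_cexp, e]; congr 1; push_cast; ring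

lemma tendsto_qPoch {τ : ℂ} (hτ : 0 < τ.im) : Tendsto (qPoch τ) atTop (𝓝 (qPochInf τ)) := by
  have h := (ModularForm.multipliable_one_sub_pow (norm_e_lt_one hτ)).tendsto_prod_tprod_nat
  have h2 : ∀ n : ℕ, e τ ^ (n + 1) = e ((n + 1 : ℕ) * τ) := fun n => e_pow _ _
  simp only [h2] at h
  simp only [qPochInf, eta_q_eq_e]
  exact h

lemma qPochInf_ne_zero {τ : ℂ} (hτ : 0 < τ.im) : qPochInf τ ≠ 0 :=
  ModularForm.eta_tprod_ne_zero hτ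

/-- `1 / ∏_{i=1}^n (1 - q^i)`, extended by zero to negative `n`. -/
def qPochInv (τ : ℂ) (n : ℤ) : ℂ := if n < 0 then 0 else (qPoch τ n.toNat)⁻¹

lemma qPochInv_of_neg (τ : ℂ) {n : ℤ} (hn : n < 0) : qPochInv τ n = 0 := if_pos hn

lemma qPochInv_natCast (τ : ℂ) (n : ℕ) : qPochInv τ n = (qPoch τ n)⁻¹ := by
  simp [qPochInv]

/-- The extension by zero fits the recurrence at n = 0, where 1 - q^0 = 0, so the coefficient
recurrence below has no boundary cases. -/
lemma qPochInv_sub_one {τ : ℂ} (hτ : 0 < τ.im) (n : ℤ) :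
    qPochInv τ (n - 1) = (1 - e (n * τ)) * qPochInv τ n := by
  rcases lt_trichotomy n 0 with h | rfl | h
  · rw [qPochInv_of_neg τ h, qPochInv_of_neg τ (by lia), mul_zero]
  · rw [qPochInv_of_neg τ (by lia)]; simp [e_zero]
  · obtain ⟨k, rfl⟩ : ∃ k : ℕ, n = (k + 1 : ℕ) := ⟨(n - 1).toNat, by lia⟩
    have h1 : ((k + 1 : ℕ) : ℤ) - 1 = k := by push_cast; ring
    rw [h1, qPochInv_natCast, qPochInv_natCast, qPoch_succ]
    have h2 := qPoch_ne_zero hτ (k + 1)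
    rw [qPoch_succ] at h2
    have h3 := left_ne_zero_of_mul h2
    have h4 := right_ne_zero_of_mul h2
    rw [Int.cast_natCast]
    field_simp

lemma tendsto_qPochInv {τ : ℂ} (hτ : 0 < τ.im) :
    Tendsto (qPochInv τ) atTop (𝓝 (qPochInf τ)⁻¹) := by
  have h0 : Tendsto Int.toNat atTop atTop :=
    tendsto_atTop_atTop.2 fun b => ⟨b, fun a ha => by lia⟩
  refine (((tendsto_qPoch hτ).inv₀ (qPochInf_ne_zero hτ)).comp h0).congr' ?_
  filter_upwards [eventually_ge_atTop 0] with n hn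
  simp [qPochInv, not_lt.2 hn]

lemma exists_norm_qPoch_le {τ : ℂ} (hτ : 0 < τ.im) :
    ∃ C : ℝ, 0 ≤ C ∧ (∀ n, ‖qPoch τ n‖ ≤ C) ∧ ∀ n, ‖qPochInv τ n‖ ≤ C := by
  obtain ⟨C, hC⟩ := (Metric.isBounded_range_of_tendsto _ (tendsto_qPoch hτ)).exists_norm_le
  obtain ⟨D, hD⟩ := (Metric.isBounded_range_of_tendsto _
    ((tendsto_qPoch hτ).inv₀ (qPochInf_ne_zero hτ))).exists_norm_le
  have hC' : ∀ n, ‖qPoch τ n‖ ≤ C := fun n => hC _ ⟨n, rfl⟩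
  have hD' : ∀ n, ‖(qPoch τ n)⁻¹‖ ≤ D := fun n => hD _ ⟨n, rfl⟩
  refine ⟨max C D, le_max_of_le_left ((norm_nonneg _).trans (hC' 0)),
    fun n => (hC' n).trans (le_max_left _ _), fun n => ?_⟩
  rw [qPochInv]
  split_ifs
  · rw [norm_zero]; exact le_max_of_le_left ((norm_nonneg _).trans (hC' 0))
  · exact (hD' _).trans (le_max_right _ _)

/-- The coefficients of the finite triple product
`∏_{i=0}^n (1 - y q^i) ∏_{i=1}^n (1 - q^i / y)`. -/
def finTripleCoeff (τ : ℂ) (n : ℕ) (k : ℤ) : ℂ :=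
  thCoeff τ k * (qPoch τ (2 * n + 1) * qPochInv τ (n + k) * qPochInv τ (n + 1 - k))

lemma thCoeff_add_one (τ : ℂ) (k : ℤ) : thCoeff τ (k + 1) = -(thCoeff τ k * e (k * τ)) := by
  rw [thCoeff, thCoeff, neg_one_zpow_add, zpow_one]
  have : e (τ * (((k + 1 : ℤ) : ℂ) * ((k + 1 : ℤ) - 1) / 2)) =
      e (τ * (k * (k - 1) / 2)) * e (k * τ) := by
    rw [← e_add]; congr 1; push_cast; ring
  rw [this]; ring

/-- This is multiplication by (1 - yQ)(1 - Q/y) = 1 + Q² - Q(y + 1/y) with Q = q^{n+1}, read on the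
coefficient of y^k. -/
lemma finTripleCoeff_succ {τ : ℂ} (hτ : 0 < τ.im) (n : ℕ) (k : ℤ) :
    finTripleCoeff τ (n + 1) k = (1 + e ((n + 1 : ℕ) * τ) ^ 2) * finTripleCoeff τ n k -
      e ((n + 1 : ℕ) * τ) * (finTripleCoeff τ n (k - 1) + finTripleCoeff τ n (k + 1)) := by
  have ht := thCoeff_add_one τ (k - 1)
  rw [sub_add_cancel] at ht
  have hR1 := qPochInv_sub_one hτ (n + 1 + k)
  have hR2 := qPochInv_sub_one hτ (n + k)
  have hS1 := qPochInv_sub_one hτ (n + 2 - k)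
  have hS2 := qPochInv_sub_one hτ (n + 1 - k)
  rw [show (n : ℤ) + 1 + k - 1 = n + k by ring] at hR1
  rw [show (n : ℤ) + 2 - k - 1 = n + 1 - k by ring] at hS1
  simp only [finTripleCoeff]
  rw [show 2 * (n + 1) + 1 = 2 * n + 1 + 1 + 1 by ring, qPoch_succ, qPoch_succ, thCoeff_add_one,
    ht, show ((n + 1 : ℕ) : ℤ) + k = n + 1 + k by push_cast; ring,
    show ((n + 1 : ℕ) : ℤ) + 1 - k = n + 2 - k by push_cast; ring,
    show (n : ℤ) + (k - 1) = n + k - 1 by ring, show (n : ℤ) + 1 - (k - 1) = n + 2 - k by ring,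
    show (n : ℤ) + (k + 1) = n + 1 + k by ring, show (n : ℤ) + 1 - (k + 1) = n + 1 - k - 1 by ring,
    hR2, hS2, hR1, hS1]
  generalize qPochInv τ (n + 1 + k) = R
  generalize qPochInv τ (n + 2 - k) = S
  generalize qPoch τ (2 * n + 1) = P
  have hk : thCoeff τ (k - 1) * e ((k - 1 : ℤ) * τ) = thCoeff τ (k - 1) * (e (k * τ) * (e τ)⁻¹) := by
    rw [← e_neg, ← e_add]; congr 2; push_cast; ring
  have e1 : e ((2 * n + 1 + 1 : ℕ) * τ) = e (n * τ) ^ 2 * e τ ^ 2 := by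
    rw [e_pow, e_pow, ← e_add]; congr 1; push_cast; ring
  have e2 : e ((2 * n + 1 + 1 + 1 : ℕ) * τ) = e (n * τ) ^ 2 * e τ ^ 3 := by
    rw [e_pow, e_pow, ← e_add]; congr 1; push_cast; ring
  have e3 : e ((n + 1 : ℕ) * τ) = e (n * τ) * e τ := by
    rw [← e_add]; congr 1; push_cast; ring
  have e4 : e ((n + 1 + k : ℤ) * τ) = e (n * τ) * e τ * e (k * τ) := by
    rw [← e_add, ← e_add]; congr 1; push_cast; ring
  have e5 : e ((n + k : ℤ) * τ) = e (n * τ) * e (k * τ) := by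
    rw [← e_add]; congr 1; push_cast; ring
  have e6 : e ((n + 2 - k : ℤ) * τ) = e (n * τ) * e τ ^ 2 * (e (k * τ))⁻¹ := by
    rw [e_pow, ← e_neg, ← e_add, ← e_add]; congr 1; push_cast; ring
  have e7 : e ((n + 1 - k : ℤ) * τ) = e (n * τ) * e τ * (e (k * τ))⁻¹ := by
    rw [← e_neg, ← e_add, ← e_add]; congr 1; push_cast; ring
  rw [hk, e1, e2, e3, e4, e5, e6, e7]
  have h1 := e_ne_zero τ
  have h2 := e_ne_zero (k * τ)
  generalize e τ = q at *
  generalize e (k * τ) = y at *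
  generalize e (n * τ) = x at *
  field_simp
  ring

lemma finTripleCoeff_eq_zero (τ : ℂ) (n : ℕ) {k : ℤ}
    (hk : k ∉ Finset.Icc (-n : ℤ) (n + 1)) : finTripleCoeff τ n k = 0 := by
  rw [Finset.mem_Icc, not_and_or] at hk
  rcases hk with hk | hk
  · rw [finTripleCoeff, qPochInv_of_neg τ (n := n + k) (by lia)]; ring
  · rw [finTripleCoeff, qPochInv_of_neg τ (n := n + 1 - k) (by lia)]; ring

lemma summable_mul_finTripleCoeff (τ : ℂ) (n : ℕ) (g : ℤ → ℂ) :
    Summable fun k => g k * finTripleCoeff τ n k :=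
  summable_of_ne_finset_zero (s := Finset.Icc (-n : ℤ) (n + 1)) fun k hk => by
    rw [finTripleCoeff_eq_zero τ n hk, mul_zero]

/-- The derivative of the finite product at its zero y = 1. In the recurrence the two shifts of k
average out, so each step multiplies by 1 - 2Q + Q² = (1-Q)². -/
lemma tsum_mul_finTripleCoeff {τ : ℂ} (hτ : 0 < τ.im) (n : ℕ) :
    ∑' k : ℤ, (k : ℂ) * finTripleCoeff τ n k = -qPoch τ n ^ 2 := by
  induction n with
  | zero =>
    rw [tsum_eq_sum (s := Finset.Icc (0 : ℤ) 1) fun k hk => by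
      rw [finTripleCoeff_eq_zero τ 0 (by simpa using hk), mul_zero]]
    have : Finset.Icc (0 : ℤ) 1 = {0, 1} := rfl
    rw [this, Finset.sum_pair (by norm_num)]
    have h := qPochInv_natCast τ 1
    have h0 := qPochInv_natCast τ 0
    rw [Nat.cast_one] at h
    rw [Nat.cast_zero] at h0
    have h2 := qPoch_ne_zero hτ 1
    have h3 : qPoch τ 0 = 1 := rfl
    simp [finTripleCoeff, h, h0, h3, thCoeff, e_zero, h2]
  | succ n ih =>
    have hs := summable_mul_finTripleCoeff τ n
    have h1 : ∑' k : ℤ, (k : ℂ) * finTripleCoeff τ n (k - 1) =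
        ∑' k : ℤ, ((k : ℂ) + 1) * finTripleCoeff τ n k := by
      rw [← (Equiv.addRight (1 : ℤ)).tsum_eq]; simp
    have h2 : ∑' k : ℤ, (k : ℂ) * finTripleCoeff τ n (k + 1) =
        ∑' k : ℤ, ((k : ℂ) - 1) * finTripleCoeff τ n k := by
      rw [← (Equiv.subRight (1 : ℤ)).tsum_eq]; simp
    have hs1 : Summable fun k : ℤ => (k : ℂ) * finTripleCoeff τ n (k - 1) := by
      rw [← (Equiv.addRight (1 : ℤ)).summable_iff]
      simpa [Function.comp_def] using hs fun k => (k : ℂ) + 1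
    have hs2 : Summable fun k : ℤ => (k : ℂ) * finTripleCoeff τ n (k + 1) := by
      rw [← (Equiv.subRight (1 : ℤ)).summable_iff]
      simpa [Function.comp_def] using hs fun k => (k : ℂ) - 1
    have hs0 := hs fun k => (k : ℂ)
    have h3 : ∑' k : ℤ, ((k : ℂ) + 1) * finTripleCoeff τ n k +
        ∑' k : ℤ, ((k : ℂ) - 1) * finTripleCoeff τ n k =
        2 * ∑' k : ℤ, (k : ℂ) * finTripleCoeff τ n k := by
      rw [← (hs _).tsum_add (hs _), ← tsum_mul_left]
      exact tsum_congr fun k => by ring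
    calc _ = ∑' k : ℤ, ((1 + e ((n + 1 : ℕ) * τ) ^ 2) * ((k : ℂ) * finTripleCoeff τ n k) -
          e ((n + 1 : ℕ) * τ) * ((k : ℂ) * finTripleCoeff τ n (k - 1) +
            (k : ℂ) * finTripleCoeff τ n (k + 1))) := tsum_congr fun k => by
          rw [finTripleCoeff_succ hτ]; ring
      _ = -qPoch τ (n + 1) ^ 2 := by
          rw [(hs0.mul_left _).tsum_sub ((hs1.add hs2).mul_left _), tsum_mul_left, tsum_mul_left,
            hs1.tsum_add hs2, h1, h2, h3, ih, qPoch_succ]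
          ring

/-- At z = ±i the exponentials have norm exp(∓2πk), and their sum dominates |k|. -/
lemma summable_norm_int_mul {f : ℤ → ℂ} (hf : ∀ z : ℂ, Summable fun k : ℤ => ‖f k * e (k * z)‖) :
    Summable fun k : ℤ => ‖(k : ℂ) * f k‖ := by
  refine Summable.of_nonneg_of_le (fun _ => norm_nonneg _) (fun k => ?_)
    ((hf Complex.I).add (hf (-Complex.I)))
  have h1 : ‖e (k * Complex.I)‖ = Real.exp (-(2 * Real.pi * k)) := by rw [norm_e]; simp
  have h2 : ‖e (k * -Complex.I)‖ = Real.exp (2 * Real.pi * k) := by rw [norm_e]; simp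
  rw [norm_mul, norm_mul, norm_mul, h1, h2, mul_comm, ← mul_add]
  refine mul_le_mul_of_nonneg_left ?_ (norm_nonneg _)
  rw [Complex.norm_intCast]
  have h3 : |(k : ℝ)| ≤ 2 * Real.pi * |(k : ℝ)| := by
    nlinarith [abs_nonneg (k : ℝ), Real.pi_gt_three]
  refine h3.trans ?_
  rcases abs_cases (k : ℝ) with ⟨h, -⟩ | ⟨h, -⟩ <;> rw [h]
  · linarith [Real.add_one_le_exp (2 * Real.pi * k), Real.exp_pos (-(2 * Real.pi * k))]
  · linarith [Real.add_one_le_exp (-(2 * Real.pi * k)), Real.exp_pos (2 * Real.pi * k)]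

lemma summable_norm_int_mul_thCoeff {τ : ℂ} (hτ : 0 < τ.im) :
    Summable fun k : ℤ => ‖(k : ℂ) * thCoeff τ k‖ :=
  summable_norm_int_mul fun z => (summable_thCoeff_mul hτ z).norm

lemma tsum_int_mul_thCoeff {τ : ℂ} (hτ : 0 < τ.im) :
    ∑' k : ℤ, (k : ℂ) * thCoeff τ k = -qPochInf τ ^ 3 := by
  obtain ⟨C, hC0, hC1, hC2⟩ := exists_norm_qPoch_le hτ
  have h0 := qPochInf_ne_zero hτ
  have hlim : Tendsto (fun n : ℕ => ∑' k : ℤ, (k : ℂ) * finTripleCoeff τ n k) atTop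
      (𝓝 (∑' k : ℤ, (k : ℂ) * (thCoeff τ k *
        (qPochInf τ * (qPochInf τ)⁻¹ * (qPochInf τ)⁻¹)))) := by
    refine tendsto_tsum_of_dominated_convergence
      (bound := fun k : ℤ => ‖(k : ℂ) * thCoeff τ k‖ * (C * C * C))
      ((summable_norm_int_mul_thCoeff hτ).mul_right _) (fun k => ?_)
      (Eventually.of_forall fun n k => ?_)
    · refine Tendsto.const_mul _ (Tendsto.const_mul _ ((Tendsto.mul ?_ ?_).mul ?_))
      · exact (tendsto_qPoch hτ).comp
          (tendsto_atTop_mono (fun n : ℕ => show n ≤ 2 * n + 1 by lia) tendsto_id)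
      · exact (tendsto_qPochInv hτ).comp
          (tendsto_atTop_add_const_right _ _ tendsto_natCast_atTop_atTop)
      · refine (tendsto_qPochInv hτ).comp ?_
        simp only [add_sub_assoc]
        exact tendsto_atTop_add_const_right _ _ tendsto_natCast_atTop_atTop
    · rw [finTripleCoeff, ← mul_assoc, norm_mul]
      refine mul_le_mul_of_nonneg_left ?_ (norm_nonneg _)
      rw [norm_mul, norm_mul]
      exact mul_le_mul (mul_le_mul (hC1 _) (hC2 _) (norm_nonneg _) hC0) (hC2 _) (norm_nonneg _)
        (mul_nonneg hC0 hC0)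
  -- Termwise, the ratio of products tends to 1/∏(1-q^i), while the closed form tends to -∏(1-q^i)²;
  -- comparing the limits produces the cube.
  have hlim2 : Tendsto (fun n : ℕ => ∑' k : ℤ, (k : ℂ) * finTripleCoeff τ n k) atTop
      (𝓝 (-qPochInf τ ^ 2)) := by
    simp only [tsum_mul_finTripleCoeff hτ]
    exact ((tendsto_qPoch hτ).pow 2).neg
  have h := tendsto_nhds_unique hlim hlim2
  rw [mul_inv_cancel₀ h0, one_mul] at h
  simp only [← mul_assoc, tsum_mul_right] at h
  rw [mul_inv_eq_iff_eq_mul₀ h0] at h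
  rw [h]; ring

/-- Jacobi's identity for the cube of the Euler product. -/
theorem tsum_thPartial {τ : ℂ} (hτ : 0 < τ.im) : ∑' n, thPartial τ n = qPochInf τ ^ 3 := by
  have hd : Summable (thPartial τ) := by
    simpa [e_zero] using (summable_norm_thPartial_mul hτ 0).of_norm
  have hk : Summable fun n : ℤ => (n : ℂ) * thPartial τ n :=
    (summable_norm_int_mul (summable_norm_thPartial_mul hτ)).of_norm
  have h1 : Summable fun n : ℤ => (n : ℂ) * thPartial τ (n - 1) := by
    rw [← (Equiv.addRight (1 : ℤ)).summable_iff]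
    simpa [Function.comp_def, add_mul] using hk.add hd
  have h2 : ∑' n : ℤ, (n : ℂ) * thPartial τ (n - 1) =
      ∑' n : ℤ, (n : ℂ) * thPartial τ n + ∑' n, thPartial τ n := by
    rw [← hk.tsum_add hd, ← (Equiv.addRight (1 : ℤ)).tsum_eq]
    simp [add_mul]
  have h3 := tsum_int_mul_thCoeff hτ
  -- Abel summation: ∑ n (D_n - D_{n-1}) = -∑ D_n.
  simp only [← thPartial_sub hτ, mul_sub] at h3
  rw [hk.tsum_sub h1, h2] at h3
  linear_combination -h3

/-! ### Passage to ϑ₁₁ and η -/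

lemma e_half : e (1 / 2) = -1 := by
  rw [e, show 2 * Real.pi * Complex.I * (1 / 2) = Real.pi * Complex.I by ring,
    Complex.exp_pi_mul_I]

lemma e_quarter : e (1 / 4) = Complex.I := by
  rw [e, show 2 * Real.pi * Complex.I * (1 / 4) = Real.pi / 2 * Complex.I by ring,
    Complex.exp_pi_div_two_mul_I]

lemma neg_one_zpow_eq_e (k : ℤ) : (-1 : ℂ) ^ k = e (k / 2) := by
  rw [← e_half, e_zpow]; congr 1; ring

lemma vartheta11_eq (τ z : ℂ) : vartheta11 τ z = -Complex.I * e (τ / 8 - z / 2) * th τ z := by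
  rw [vartheta11, th, ← tsum_mul_left, ← (Equiv.subRight (1 : ℤ)).tsum_eq]
  refine tsum_congr fun k => ?_
  have hI : -Complex.I = e (-(1 / 4)) := by rw [e_neg, e_quarter, Complex.inv_I]
  rw [thCoeff, hI, neg_one_zpow_eq_e]
  simp only [← e_add]
  rw [e]
  congr 1
  simp only [Equiv.subRight_apply]
  push_cast
  ring

lemma eta_pow_three (τ : ℂ) : ModularForm.eta τ ^ 3 = e (τ / 8) * qPochInf τ ^ 3 := by
  rw [ModularForm.eta, mul_pow, Function.Periodic.qParam, ← Complex.exp_nat_mul, qPochInf, e]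
  congr 2
  push_cast
  ring

lemma e_add_mul_ne_one {τ z : ℂ} (hz : ∀ a b : ℤ, z ≠ a + b * τ) (j : ℤ) :
    e (z + j * τ) ≠ 1 := by
  rw [Ne, e_eq_one_iff]
  rintro ⟨a, ha⟩
  exact hz a (-j) (by push_cast; linear_combination ha)

lemma th_mul_tsum_apTerm_eq {τ z : ℂ} (hτ : 0 < τ.im) (hz : ∀ a b : ℤ, z ≠ a + b * τ) :
    th τ z * ∑' j : ℤ, apTerm τ z j = qPochInf τ ^ 3 :=
  (th_mul_tsum_apTerm hτ (e_add_mul_ne_one hz)).trans (tsum_thPartial hτ)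

lemma th_ne_zero {τ z : ℂ} (hτ : 0 < τ.im) (hz : ∀ a b : ℤ, z ≠ a + b * τ) : th τ z ≠ 0 :=
  left_ne_zero_of_mul (b := ∑' j : ℤ, apTerm τ z j)
    ((th_mul_tsum_apTerm_eq hτ hz).trans_ne (pow_ne_zero 3 (qPochInf_ne_zero hτ)))

lemma vartheta11_ne_zero {τ z : ℂ} (hτ : 0 < τ.im) (hz : ∀ a b : ℤ, z ≠ a + b * τ) :
    vartheta11 τ z ≠ 0 := by
  rw [vartheta11_eq]
  exact mul_ne_zero (mul_ne_zero (neg_ne_zero.2 Complex.I_ne_zero) (e_ne_zero _))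
    (th_ne_zero hτ hz)

lemma tsum_apTerm {τ z : ℂ} (hτ : 0 < τ.im) (hz : ∀ a b : ℤ, z ≠ a + b * τ) :
    ∑' j : ℤ, apTerm τ z j =
      -(Complex.I * ModularForm.eta τ ^ 3) * e (-(z / 2)) / vartheta11 τ z := by
  rw [eq_div_iff (vartheta11_ne_zero hτ hz), eta_pow_three, ← th_mul_tsum_apTerm_eq hτ hz,
    vartheta11_eq, sub_eq_add_neg, e_add]
  ring

/-- Theta times this series is the same constant at z and at z+lτ, so the series transforms
inversely to theta. -/
lemma tsum_apTerm_add_mul {τ z : ℂ} (hτ : 0 < τ.im) (hz : ∀ a b : ℤ, z ≠ a + b * τ) (l : ℤ) :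
    ∑' j : ℤ, apTerm τ (z + l * τ) j =
      (-1) ^ l * e (l * z + τ * (l * (l - 1) / 2)) * ∑' j : ℤ, apTerm τ z j := by
  have hz' : ∀ a b : ℤ, z + l * τ ≠ a + b * τ := fun a b h =>
    hz a (b - l) (by push_cast; linear_combination h)
  have h1 := th_mul_tsum_apTerm_eq hτ hz'
  have h2 := th_mul_tsum_apTerm_eq hτ hz
  refine mul_left_cancel₀ (th_ne_zero hτ hz') (h1.trans ?_)
  rw [← h2, th_add_mul]
  have h3 : e (-(l * z) - τ * (l * (l - 1) / 2)) * e (l * z + τ * (l * (l - 1) / 2)) = 1 := by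
    rw [← e_add, ← e_zero]; congr 1; ring
  linear_combination (-(th τ z * ∑' j : ℤ, apTerm τ z j)) *
    ((-1) ^ l * (-1) ^ l * h3 + neg_one_zpow_mul_self l)

/-! ### Appell series -/

lemma tendsto_e_add_mul {τ : ℂ} (hτ : 0 < τ.im) (z : ℂ) :
    Tendsto (fun n : ℕ => e (z + n * τ)) atTop (𝓝 0) := by
  have h := (tendsto_pow_atTop_nhds_zero_of_norm_lt_one (norm_e_lt_one hτ)).const_mul (e z)
  simpa only [e_pow, ← e_add, mul_zero] using h

/-- The values tend to 1 as l → +∞ and to 0 as l → -∞, so they are bounded. No condition on z is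
needed, since a pole contributes 0⁻¹ = 0. -/
lemma exists_norm_inv_one_sub_le {τ z : ℂ} (hτ : 0 < τ.im) :
    ∃ C : ℝ, ∀ l : ℤ, ‖(1 - e (z + l * τ))⁻¹‖ ≤ C := by
  have h1 : Tendsto (fun n : ℕ => (1 - e (z + n * τ))⁻¹) atTop (𝓝 (1 - 0)⁻¹) :=
    (tendsto_const_nhds.sub (tendsto_e_add_mul hτ z)).inv₀ (by simp)
  have h2 : Tendsto (fun n : ℕ => -e (-z + n * τ) * (1 - e (-z + n * τ))⁻¹) atTop
      (𝓝 (-0 * (1 - 0)⁻¹)) :=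
    (tendsto_e_add_mul hτ (-z)).neg.mul
      ((tendsto_const_nhds.sub (tendsto_e_add_mul hτ (-z))).inv₀ (by simp))
  obtain ⟨C, hC⟩ := (Metric.isBounded_range_of_tendsto _ h1).exists_norm_le
  obtain ⟨D, hD⟩ := (Metric.isBounded_range_of_tendsto _ h2).exists_norm_le
  refine ⟨max C D, fun l => ?_⟩
  obtain ⟨n, rfl | rfl⟩ := l.eq_nat_or_neg
  · exact (hC _ ⟨n, rfl⟩).trans (le_max_left _ _)
  · refine le_trans (le_of_eq ?_) ((hD _ ⟨n, rfl⟩).trans (le_max_right _ _))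
    congr 1
    rw [show z + ((-(n : ℤ) : ℤ) : ℂ) * τ = -(-z + n * τ) by push_cast; ring, e_neg]
    have key : ∀ x : ℂ, x ≠ 0 → (1 - x⁻¹)⁻¹ = -x * (1 - x)⁻¹ := fun x hx => by
      rw [show 1 - x⁻¹ = -x⁻¹ * (1 - x) by field_simp; ring, mul_inv, inv_neg, inv_inv]
    exact key _ (e_ne_zero _)

/-- The terms of the Appell series. -/
def appellTerm (m : ℝ) (τ Z z : ℂ) (l : ℤ) : ℂ :=
  e (m * l * Z + τ * (m * l ^ 2)) / (1 - e (z + l * τ))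

lemma summable_appellTerm {m : ℝ} (hm : 0 < m) {τ : ℂ} (hτ : 0 < τ.im) (Z z : ℂ) :
    Summable fun l => ‖appellTerm m τ Z z l‖ := by
  obtain ⟨C, hC⟩ := exists_norm_inv_one_sub_le (z := z) hτ
  have hmτ : 0 < (m * τ).im := by simpa using mul_pos hm hτ
  refine Summable.of_nonneg_of_le (fun _ => norm_nonneg _) (fun l => ?_)
    ((summable_norm_e_quadratic hmτ (m * Z) 0).mul_right C)
  rw [appellTerm, div_eq_mul_inv, norm_mul,
    show (m : ℂ) * l * Z + τ * (m * l ^ 2) = m * τ * l ^ 2 + m * Z * l + 0 by ring]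
  exact mul_le_mul_of_nonneg_left (hC l) (norm_nonneg _)

/-- The denominator depends only on the sum of the two indices and its inverse is uniformly bounded;
the numerators form a product of Gaussians. -/
lemma summable_apTerm_mul {m : ℝ} (hm : 0 < m) {τ : ℂ} (hτ : 0 < τ.im) (Z z : ℂ) :
    Summable fun p : ℤ × ℤ =>
      apTerm τ (z + p.2 * τ) p.1 * e (m * p.2 * Z + τ * (m * p.2 ^ 2)) := by
  obtain ⟨C, hC⟩ := exists_norm_inv_one_sub_le (z := z) hτ
  have hmτ : 0 < (m * τ).im := by simpa using mul_pos hm hτ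
  have hs := ((summable_norm_e_quadratic (a := τ / 2) (by simpa using hτ) (τ / 2) 0).mul_of_nonneg
    (summable_norm_e_quadratic hmτ (m * Z) 0)
    (fun _ => norm_nonneg _) (fun _ => norm_nonneg _)).mul_left C
  refine Summable.of_norm_bounded hs fun p => ?_
  have h := hC (p.1 + p.2)
  rw [show z + ((p.1 + p.2 : ℤ) : ℂ) * τ = z + p.2 * τ + p.1 * τ by push_cast; ring] at h
  rw [apTerm, div_eq_mul_inv, norm_mul, norm_mul, norm_mul, norm_neg_one_zpow, one_mul,
    show (m : ℂ) * p.2 * Z + τ * (m * p.2 ^ 2) = m * τ * p.2 ^ 2 + m * Z * p.2 + 0 by ring,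
    show τ * ((p.1 : ℂ) * (p.1 + 1) / 2) = τ / 2 * p.1 ^ 2 + τ / 2 * p.1 + 0 by ring,
    mul_right_comm, mul_comm C]
  exact mul_le_mul_of_nonneg_left h (by positivity)

lemma ofReal_add_half_ne_zero {m : ℝ} (hm : 0 < m) : (m : ℂ) + 1 / 2 ≠ 0 := fun h => by
  have := congrArg Complex.re h
  simp at this
  linarith

/-! ### The coefficients c_{j,k} -/

lemma coeff_eq (m : ℝ) (τ w : ℂ) (j : ℤ) (k : ℝ) :
    coeff m τ w j k = coeff m τ w j 0 * e (-(τ * (k ^ 2 / (4 * m))) - k * w / 2) := by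
  simp only [coeff, qPow_eq_e]
  have h1 : ∀ x : ℂ, Complex.exp (-(Real.pi * Complex.I * x * w)) = e (-(x * w / 2)) := fun x => by
    rw [e]; congr 1; ring
  rw [h1, h1, sub_eq_add_neg, e_add, show -(τ * ((k : ℂ) ^ 2 / (4 * m))) = τ * -(k ^ 2 / (4 * m)) by ring]
  simp [e_zero]
  ring

lemma coeff_zero_eq {m : ℝ} (hm : 0 < m) (τ w : ℂ) (j : ℤ) :
    coeff m τ w j 0 = e (τ / (16 * (m + 1 / 2)) + m * w / (4 * (m + 1 / 2))) *
      ((-1) ^ j * e (τ * ((m + 1 / 2) * j ^ 2 + j / 2) + m * j * w)) := by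
  simp only [coeff, qPow_eq_e]
  have h1 : ∀ x : ℂ, Complex.exp (2 * Real.pi * Complex.I * m * x * w) = e (m * x * w) := fun x => by
    rw [e]; congr 1; ring
  have hm' := ofReal_add_half_ne_zero hm
  have h2 : e (τ * ((m + 1 / 2) * (j + 1 / (4 * (m + 1 / 2))) ^ 2)) *
      e (m * (j + 1 / (4 * (m + 1 / 2))) * w) =
      e (τ / (16 * (m + 1 / 2)) + m * w / (4 * (m + 1 / 2))) *
      e (τ * ((m + 1 / 2) * j ^ 2 + j / 2) + m * j * w) := by
    rw [← e_add, ← e_add]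
    congr 1
    generalize (m : ℂ) + 1 / 2 = x at *
    field_simp
    ring
  rw [h1]
  simp only [Complex.ofReal_zero, mul_zero, zero_mul, neg_zero, Complex.exp_zero, mul_one,
    ne_eq, OfNat.ofNat_ne_zero, not_false_eq_true, zero_pow, zero_div, e_zero]
  linear_combination (-1) ^ j * h2

lemma summable_coeff_zero {m : ℝ} (hm : 0 < m) {τ : ℂ} (hτ : 0 < τ.im) (w : ℂ) :
    Summable fun j => ‖coeff m τ w j 0‖ := by
  have hmτ : 0 < (((m + 1 / 2 : ℝ) : ℂ) * τ).im := by
    rw [Complex.im_ofReal_mul]; exact mul_pos (by positivity) hτ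
  refine summable_norm_of_eq_e_quadratic hmτ (τ / 2 + m * w)
    (τ / (16 * (m + 1 / 2)) + m * w / (4 * (m + 1 / 2))) fun j => ?_
  rw [coeff_zero_eq hm, mul_left_comm, norm_mul, norm_neg_one_zpow, one_mul, ← e_add]
  congr 2
  push_cast
  ring

lemma tsum_coeff_zero {m : ℝ} (hm : 0 < m) (τ w : ℂ) :
    ∑' j, coeff m τ w j 0 = thetaSgn (-1) (1 / 2) (m + 1 / 2) τ (m * w / (m + 1 / 2)) := by
  have hm' := ofReal_add_half_ne_zero hm
  rw [thetaSgn]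
  refine tsum_congr fun j => ?_
  simp only [coeff]
  have h1 : (1 / 2 : ℂ) / (2 * (m + 1 / 2)) = 1 / (4 * (m + 1 / 2)) := by
    field_simp; norm_num
  push_cast
  rw [h1]
  simp only [mul_zero, zero_mul, neg_zero, Complex.exp_zero, mul_one,
    ne_eq, OfNat.ofNat_ne_zero, not_false_eq_true, zero_pow, zero_div, qPow_eq_e, e_zero]
  congr 2
  generalize (m : ℂ) + 1 / 2 = x at *
  field_simp

/-! ### Signed geometric sums and the product with one Appell series -/

/-- The signed sum over `0 < k ≤ L` if `0 ≤ L`, and over `L < k ≤ 0` if `L ≤ 0`. -/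
def signedSum (L : ℤ) (f : ℤ → ℂ) : ℂ :=
  ∑ k ∈ Finset.Ioc 0 L, f k - ∑ k ∈ Finset.Ioc L 0, f k

lemma signedSum_zero (f : ℤ → ℂ) : signedSum 0 f = 0 := by simp [signedSum]

lemma signedSum_add_one (L : ℤ) (f : ℤ → ℂ) : signedSum (L + 1) f = signedSum L f + f (L + 1) := by
  rw [signedSum, signedSum]
  rcases le_or_gt 0 L with h | h
  · have h1 : Finset.Ioc 0 (L + 1) = insert (L + 1) (Finset.Ioc 0 L) := by ext; simp; lia
    rw [h1, Finset.sum_insert (by simp), Finset.Ioc_eq_empty (by lia : ¬L < 0),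
      Finset.Ioc_eq_empty (by lia : ¬L + 1 < 0)]
    ring
  · have h1 : Finset.Ioc L 0 = insert (L + 1) (Finset.Ioc (L + 1) 0) := by ext; simp; lia
    rw [h1, Finset.sum_insert (by simp), Finset.Ioc_eq_empty (by lia : ¬0 < L),
      Finset.Ioc_eq_empty (by lia : ¬0 < L + 1)]
    ring

lemma signedSum_zpow_neg {y : ℂ} (hy : y ≠ 0) (L : ℤ) :
    signedSum L (fun k => y ^ (-k)) * (1 - y) = y ^ (-L) - 1 := by
  have key : ∀ L : ℤ, signedSum (L + 1) (fun k => y ^ (-k)) * (1 - y) - (y ^ (-(L + 1)) - 1) =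
      signedSum L (fun k => y ^ (-k)) * (1 - y) - (y ^ (-L) - 1) := fun L => by
    rw [signedSum_add_one]
    have : y ^ (-L) = y ^ (-(L + 1)) * y := by
      rw [← zpow_add_one₀ hy]; congr 1; ring
    rw [this]; ring
  refine sub_eq_zero.1 ?_
  induction L using Int.induction_on with
  | zero => simp [signedSum_zero]
  | succ n ih => rw [key, ih]
  | pred n ih => rw [← key, sub_add_cancel, ih]

lemma signedSum_tsum {L : ℤ} {f : ℤ → ℤ → ℂ} (hf : ∀ k, Summable (f k)) :
    signedSum L (fun k => ∑' l, f k l) = ∑' l, signedSum L fun k => f k l := by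
  simp only [signedSum]
  rw [Summable.tsum_sub (summable_sum fun k _ => hf k) (summable_sum fun k _ => hf k),
    Summable.tsum_finsetSum fun k _ => hf k, Summable.tsum_finsetSum fun k _ => hf k]

lemma summable_signedSum {L : ℤ} {f : ℤ → ℤ → ℂ} (hf : ∀ k, Summable (f k)) :
    Summable fun l => signedSum L fun k => f k l :=
  (summable_sum fun k _ => hf k).sub (summable_sum fun k _ => hf k)

lemma mul_signedSum (c : ℂ) (L : ℤ) (f : ℤ → ℂ) :
    c * signedSum L f = signedSum L fun k => c * f k := by
  simp only [signedSum, mul_sub, Finset.mul_sum]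

lemma thetaSgn_one_eq {m : ℝ} (hm : 0 < m) (k : ℝ) (τ z : ℂ) :
    thetaSgn 1 k m τ z = e (τ * (k ^ 2 / (4 * m)) + k * z / 2) *
      ∑' l : ℤ, e (m * l * z + τ * (m * l ^ 2) + k * l * τ) := by
  rw [thetaSgn, ← tsum_mul_left]
  refine tsum_congr fun l => ?_
  have hm' : (m : ℂ) ≠ 0 := by exact_mod_cast hm.ne'
  have h1 : ∀ x : ℂ, Complex.exp (2 * Real.pi * Complex.I * m * x * z) = e (m * x * z) := fun x => by
    rw [e]; congr 1; ring
  rw [h1, qPow_eq_e, Int.cast_one, one_zpow, one_mul, ← e_add, ← e_add]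
  congr 1
  field_simp
  ring

lemma summable_theta_aux {m : ℝ} (hm : 0 < m) {τ : ℂ} (hτ : 0 < τ.im) (Z c b : ℂ) :
    Summable fun l : ℤ => e (m * l * Z + τ * (m * l ^ 2) + (c * l + b)) := by
  have hmτ : 0 < (m * τ).im := by simpa using mul_pos hm hτ
  refine ((summable_norm_e_quadratic hmτ (m * Z + c) b).of_norm).congr fun l => ?_
  congr 1; ring

lemma coeff_mul_thetaSgn {m : ℝ} (hm : 0 < m) (τ Z z : ℂ) (j : ℤ) (k : ℤ) :
    coeff m τ (2 * z - Z) j k * thetaSgn 1 (-k) m τ Z = coeff m τ (2 * z - Z) j 0 *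
      ∑' l : ℤ, e (m * l * Z + τ * (m * l ^ 2)) * e (z + l * τ) ^ (-k) := by
  rw [coeff_eq, thetaSgn_one_eq hm, mul_assoc, ← mul_assoc (e _) (e _), ← e_add, ← tsum_mul_left]
  congr 1
  refine tsum_congr fun l => ?_
  rw [e_zpow, ← e_add, ← e_add]
  congr 1
  push_cast
  ring

lemma appellTerm_eq {m : ℝ} {τ z : ℂ} (Z : ℂ) (hz : ∀ a b : ℤ, z ≠ a + b * τ) (L l : ℤ) :
    appellTerm m τ Z z l = e (z + l * τ) ^ (-L) * appellTerm m τ Z z l -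
      signedSum L fun k => e (m * l * Z + τ * (m * l ^ 2)) * e (z + l * τ) ^ (-k) := by
  have hne : 1 - e (z + l * τ) ≠ 0 := sub_ne_zero.2 (e_add_mul_ne_one hz l).symm
  have h := signedSum_zpow_neg (e_ne_zero (z + l * τ)) L
  rw [← mul_signedSum, appellTerm]
  rw [← eq_div_iff hne] at h
  rw [h]
  field_simp
  ring

/-- The geometric identity is used with L = nj = 2mj. After l ↦ l+j this choice cancels every jl, jz
and jZ term in the numerator's exponent, leaving j(j+1)/2 and the Gaussian in l. -/
lemma coeff_mul_tsum_appellTerm {n : ℕ} (hn : 0 < n) {m : ℝ} (hm : m = n / 2) {τ Z z : ℂ}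
    (hτ : 0 < τ.im) (hz : ∀ a b : ℤ, z ≠ a + b * τ) (j : ℤ) :
    coeff m τ (2 * z - Z) j 0 * ∑' l, appellTerm m τ Z z l =
      e (τ / (16 * (m + 1 / 2)) + m * (2 * z - Z) / (4 * (m + 1 / 2))) *
        (∑' l : ℤ, apTerm τ (z + l * τ) j * e (m * l * Z + τ * (m * l ^ 2))) -
      signedSum (n * j) fun k => coeff m τ (2 * z - Z) j k * thetaSgn 1 (-k) m τ Z := by
  have hm0 : 0 < m := by rw [hm]; positivity
  have hn2 : (n : ℂ) = 2 * m := by rw [hm]; push_cast; ring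
  have hs1 : ∀ k : ℤ, Summable fun l : ℤ =>
      e (m * l * Z + τ * (m * l ^ 2)) * e (z + l * τ) ^ (-k) := fun k => by
    refine (summable_theta_aux hm0 hτ Z (-k * τ) (-k * z)).congr fun l => ?_
    rw [e_zpow, ← e_add]; congr 1; push_cast; ring
  have hs2 := (summable_appellTerm hm0 hτ Z z).of_norm
  have hs3 := summable_signedSum (L := n * j) hs1
  -- Summability follows from the geometric identity, without a separate estimate.
  have hs4 : Summable fun l : ℤ => e (z + l * τ) ^ (-(n * j)) * appellTerm m τ Z z l :=
    (hs2.add hs3).congr fun l => by linear_combination appellTerm_eq Z hz (n * j) l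
  have h1 : ∑' l, appellTerm m τ Z z l =
      ∑' l : ℤ, e (z + l * τ) ^ (-(n * j)) * appellTerm m τ Z z l -
      signedSum (n * j) fun k =>
        ∑' l : ℤ, e (m * l * Z + τ * (m * l ^ 2)) * e (z + l * τ) ^ (-k) := by
    rw [signedSum_tsum hs1, ← hs4.tsum_sub hs3]
    exact tsum_congr fun l => appellTerm_eq Z hz (n * j) l
  rw [h1, mul_sub, mul_signedSum]
  simp only [coeff_mul_thetaSgn hm0]
  congr 1
  rw [← tsum_mul_left, ← tsum_mul_left, ← (Equiv.addRight j).tsum_eq]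
  refine tsum_congr fun l => ?_
  rw [coeff_zero_eq hm0, appellTerm, apTerm, e_zpow, Equiv.coe_addRight,
    show z + ((l + j : ℤ) : ℂ) * τ = z + l * τ + j * τ by push_cast; ring]
  have h2 : e (τ * ((m + 1 / 2) * j ^ 2 + j / 2) + m * j * (2 * z - Z)) *
      e ((-(n * j) : ℤ) * (z + l * τ + j * τ)) *
      e (m * (l + j : ℤ) * Z + τ * (m * (l + j : ℤ) ^ 2)) =
      e (τ * (j * (j + 1) / 2)) * e (m * l * Z + τ * (m * l ^ 2)) := by
    simp only [← e_add]
    congr 1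
    push_cast
    rw [hn2]
    ring
  linear_combination e (τ / (16 * (m + 1 / 2)) + m * (2 * z - Z) / (4 * (m + 1 / 2))) *
    (-1) ^ j / (1 - e (z + l * τ + j * τ)) * h2

/-- Summing over j first gives 1/ϑ₁₁(z) times the quasi-period factor in l. That factor adds l²/2 to
ml², and completing the square gives a theta series of degree m+1/2. -/
lemma tsum_apTerm_mul {m : ℝ} (hm : 0 < m) {τ Z z : ℂ} (hτ : 0 < τ.im)
    (hz : ∀ a b : ℤ, z ≠ a + b * τ) :
    e (τ / (16 * (m + 1 / 2)) + m * (2 * z - Z) / (4 * (m + 1 / 2))) *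
      ∑' (j : ℤ) (l : ℤ), apTerm τ (z + l * τ) j * e (m * l * Z + τ * (m * l ^ 2)) =
      -(Complex.I * ModularForm.eta τ ^ 3 *
        (thetaSgn (-1) (-1 / 2) (m + 1 / 2) τ (Z + (2 * z - Z) / (2 * m + 1)) /
          vartheta11 τ z)) := by
  have hc := Summable.tsum_comm (f := fun j l : ℤ =>
    apTerm τ (z + l * τ) j * e (m * l * Z + τ * (m * l ^ 2))) (summable_apTerm_mul hm hτ Z z)
  rw [← hc]
  simp only [tsum_mul_right, tsum_apTerm_add_mul hτ hz]
  simp only [mul_right_comm _ (∑' j : ℤ, apTerm τ z j), tsum_mul_right]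
  rw [tsum_apTerm hτ hz, thetaSgn]
  have hm' := ofReal_add_half_ne_zero hm
  have hm2 : 2 * (m : ℂ) + 1 = 2 * (m + 1 / 2) := by ring
  have h1 : ∀ x y : ℂ, Complex.exp (2 * Real.pi * Complex.I * (m + 1 / 2) * x * y) =
      e ((m + 1 / 2) * x * y) := fun x y => by
    rw [e]; congr 1; ring
  have h2 : ∑' l : ℤ, ((-1 : ℤ) : ℂ) ^ l *
      qPow τ ((m + 1 / 2 : ℝ) * (l + (-1 / 2 : ℝ) / (2 * (m + 1 / 2 : ℝ))) ^ 2) *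
      Complex.exp (2 * Real.pi * Complex.I * (m + 1 / 2 : ℝ) *
        (l + (-1 / 2 : ℝ) / (2 * (m + 1 / 2 : ℝ))) * (Z + (2 * z - Z) / (2 * m + 1))) =
      e (τ / (16 * (m + 1 / 2)) + m * (2 * z - Z) / (4 * (m + 1 / 2))) * e (-(z / 2)) *
      ∑' l : ℤ, (-1) ^ l * e (l * z + τ * (l * (l - 1) / 2)) *
        e (m * l * Z + τ * (m * l ^ 2)) := by
    rw [← tsum_mul_left]
    refine tsum_congr fun l => ?_
    push_cast
    rw [h1, qPow_eq_e, hm2]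
    have h3 : e (τ * ((m + 1 / 2) * (l + -1 / 2 / (2 * (m + 1 / 2))) ^ 2)) *
        e ((m + 1 / 2) * (l + -1 / 2 / (2 * (m + 1 / 2))) *
          (Z + (2 * z - Z) / (2 * (m + 1 / 2)))) =
        e (τ / (16 * (m + 1 / 2)) + m * (2 * z - Z) / (4 * (m + 1 / 2))) * e (-(z / 2)) *
          e (l * z + τ * (l * (l - 1) / 2)) * e (m * l * Z + τ * (m * l ^ 2)) := by
      rw [← e_add, ← e_add, ← e_add, ← e_add]
      congr 1
      have hm3 : (m : ℂ) = (m + 1 / 2) - 1 / 2 := by ring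
      generalize (m : ℂ) + 1 / 2 = x at *
      rw [hm3]
      field_simp
      ring
    linear_combination (-1) ^ l * h3
  rw [h2]
  ring

/-- The product of the theta series with one Appell series. -/
theorem thetaSgn_mul_tsum_appellTerm {n : ℕ} (hn : 0 < n) {m : ℝ} (hm : m = n / 2) {τ Z z : ℂ}
    (hτ : 0 < τ.im) (hz : ∀ a b : ℤ, z ≠ a + b * τ) :
    thetaSgn (-1) (1 / 2) (m + 1 / 2) τ (m * (2 * z - Z) / (m + 1 / 2)) *
        ∑' l, appellTerm m τ Z z l =
      -(∑' j : ℤ, signedSum (n * j) fun k =>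
        coeff m τ (2 * z - Z) j k * thetaSgn 1 (-k) m τ Z) -
      Complex.I * ModularForm.eta τ ^ 3 *
        (thetaSgn (-1) (-1 / 2) (m + 1 / 2) τ (Z + (2 * z - Z) / (2 * m + 1)) /
          vartheta11 τ z) := by
  have hm0 : 0 < m := by rw [hm]; positivity
  have h := coeff_mul_tsum_appellTerm hn hm (Z := Z) hτ hz
  have hs1 : Summable fun j : ℤ => coeff m τ (2 * z - Z) j 0 * ∑' l, appellTerm m τ Z z l :=
    (summable_coeff_zero hm0 hτ _).of_norm.mul_right _
  have hs2 := ((summable_apTerm_mul hm0 hτ Z z).prod).mul_left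
    (e (τ / (16 * (m + 1 / 2)) + m * (2 * z - Z) / (4 * (m + 1 / 2))))
  have h3 : ∀ j : ℤ, (signedSum (n * j) fun k =>
      coeff m τ (2 * z - Z) j k * thetaSgn 1 (-k) m τ Z) =
      e (τ / (16 * (m + 1 / 2)) + m * (2 * z - Z) / (4 * (m + 1 / 2))) *
        (∑' l : ℤ, apTerm τ (z + l * τ) j * e (m * l * Z + τ * (m * l ^ 2))) -
      coeff m τ (2 * z - Z) j 0 * ∑' l, appellTerm m τ Z z l := fun j => by
    rw [h j]; ring
  -- The j-th signed sum is now a difference of two terms already known to be summable in j.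
  simp only [h3]
  rw [Summable.tsum_sub hs2 hs1, tsum_mul_left, tsum_apTerm_mul hm0 hτ hz, tsum_mul_right,
    tsum_coeff_zero hm0]
  ring

/-! ### Symmetries of the theta functions -/

lemma thetaSgn_neg_neg {ε : ℤ} (hε : ε = 1 ∨ ε = -1) (k m : ℝ) (τ z : ℂ) :
    thetaSgn ε (-k) m τ (-z) = thetaSgn ε k m τ z := by
  rw [thetaSgn, thetaSgn, ← (Equiv.neg ℤ).tsum_eq]
  refine tsum_congr fun j => ?_
  have h : (ε : ℂ) ^ (-j) = (ε : ℂ) ^ j := by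
    rcases hε with rfl | rfl
    · simp
    · exact_mod_cast neg_one_zpow_neg j
  rw [Equiv.neg_apply, h]
  push_cast
  rw [show (-(j : ℂ) + -k / (2 * m)) ^ 2 = (j + k / (2 * m)) ^ 2 by ring]
  congr 2
  ring

lemma vartheta11_neg (τ z : ℂ) : vartheta11 τ (-z) = -vartheta11 τ z := by
  have h : th τ (-z) = -e (-z) * th τ z := by
    rw [th, th, ← tsum_mul_left, ← (Equiv.subLeft (1 : ℤ)).tsum_eq]
    refine tsum_congr fun k => ?_
    rw [Equiv.subLeft_apply, thCoeff_one_sub]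
    have : e ((1 - k : ℤ) * -z) = e (-z) * e (k * z) := by
      rw [← e_add]; congr 1; push_cast; ring
    rw [this]; ring
  rw [vartheta11_eq, vartheta11_eq, h]
  have : e (τ / 8 - -z / 2) * e (-z) = e (τ / 8 - z / 2) := by
    rw [← e_add]; congr 1; ring
  linear_combination Complex.I * th τ z * this

lemma thetaSgn_add_period {m : ℝ} (hm : 0 < m) (k : ℝ) (r : ℤ) (τ z : ℂ) :
    thetaSgn 1 (2 * m * r + k) m τ z = thetaSgn 1 k m τ z := by
  have hm' : (m : ℂ) ≠ 0 := by exact_mod_cast hm.ne'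
  rw [thetaSgn, thetaSgn]
  conv_rhs => rw [← (Equiv.addRight r).tsum_eq]
  refine tsum_congr fun j => ?_
  have : ((j + r : ℤ) : ℂ) + ((k : ℝ) : ℂ) / (2 * m) =
      (j : ℂ) + ((2 * m * r + k : ℝ) : ℂ) / (2 * m) := by
    push_cast; field_simp; ring
  rw [Equiv.coe_addRight, this, Int.cast_one, one_zpow, one_zpow]

lemma thetaSymm_neg (k m : ℝ) (τ z : ℂ) : thetaSymm (-k) m τ z = thetaSymm k m τ z := by
  rw [thetaSymm, thetaSymm, neg_neg, add_comm]

lemma thetaSymm_add_period {m : ℝ} (hm : 0 < m) (k : ℝ) (r : ℤ) (τ z : ℂ) :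
    thetaSymm (2 * m * r + k) m τ z = thetaSymm k m τ z := by
  have := thetaSgn_add_period hm (-k) (-r) τ z
  rw [thetaSymm, thetaSymm, thetaSgn_add_period hm, ← this]
  congr 2
  push_cast
  ring

/-! ### Absolute convergence over the cones -/

lemma exists_norm_thetaSgn_le {n : ℕ} (hn : 0 < n) {m : ℝ} (hm : m = n / 2) (τ z : ℂ) :
    ∃ C : ℝ, ∀ k : ℤ, ‖thetaSgn 1 k m τ z‖ ≤ C := by
  have hm0 : 0 < m := by rw [hm]; positivity
  refine ⟨∑ i ∈ Finset.Ico (0 : ℤ) n, ‖thetaSgn 1 (i : ℤ) m τ z‖, fun k => ?_⟩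
  have hk : (k : ℝ) = 2 * m * (k / n : ℤ) + (k % n : ℤ) := by
    rw [hm, mul_div_cancel₀ _ two_ne_zero]
    exact_mod_cast (Int.mul_ediv_add_emod k n).symm
  rw [hk, thetaSgn_add_period hm0]
  refine Finset.single_le_sum (f := fun i : ℤ => ‖thetaSgn 1 (i : ℤ) m τ z‖)
    (fun _ _ => norm_nonneg _) (Finset.mem_Ico.2 ⟨Int.emod_nonneg _ (by lia),
      Int.emod_lt_of_pos _ (by lia)⟩)

/-- The form (m+1/2)j² - k²/(4m) is indefinite, but for |k| ≤ 2m|j| it is at least j²/2, hence at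
least j²/4 + k²/(16m²). The slack is `δ`. -/
lemma norm_coeff_le {m : ℝ} (hm : 0 < m) {τ : ℂ} (hτ : 0 < τ.im) (w : ℂ) {j k : ℤ}
    (h : (k : ℝ) ^ 2 ≤ (2 * m * j) ^ 2) :
    ‖coeff m τ w j k‖ ≤ ‖e (τ / 4 * j ^ 2 + (τ / 2 + m * w) * j +
        (τ / (16 * (m + 1 / 2)) + m * w / (4 * (m + 1 / 2))))‖ *
      ‖e ((1 / (16 * m ^ 2) : ℝ) * τ * k ^ 2 + -(w / 2) * k + 0)‖ := by
  have hm' : (m : ℂ) ≠ 0 := by exact_mod_cast hm.ne'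
  set δ : ℝ := (m + 1 / 2) * j ^ 2 - k ^ 2 / (4 * m) - j ^ 2 / 4 - k ^ 2 / (16 * m ^ 2) with hδ
  have hδ0 : 0 ≤ δ := by
    have h1 : (k : ℝ) ^ 2 / (4 * m) ≤ m * j ^ 2 := by
      rw [div_le_iff₀ (by positivity)]; linarith
    have h2 : (k : ℝ) ^ 2 / (16 * m ^ 2) ≤ j ^ 2 / 4 := by
      rw [div_le_iff₀ (by positivity)]; linarith
    rw [hδ]; linarith
  have hnorm : ‖e (τ * δ)‖ ≤ 1 := by
    rw [norm_e, Real.exp_le_one_iff, Complex.im_mul_ofReal]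
    have := Real.pi_pos
    have : 0 ≤ 2 * Real.pi * (τ.im * δ) := by positivity
    linarith
  rw [coeff_eq, coeff_zero_eq hm, mul_left_comm, mul_assoc, norm_mul, norm_neg_one_zpow, one_mul,
    ← e_add, ← e_add, ← norm_mul, ← e_add]
  refine le_of_eq_of_le ?_ (mul_le_of_le_one_right (norm_nonneg _) hnorm)
  rw [← norm_mul, ← e_add, hδ]
  congr 2
  push_cast
  field_simp
  ring

lemma summable_coeff_mul {m : ℝ} (hm : 0 < m) {τ : ℂ} (hτ : 0 < τ.im) (w : ℂ) {g : ℤ → ℂ} {C : ℝ}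
    (hg : ∀ k, ‖g k‖ ≤ C) {A : Set (ℤ × ℤ)}
    (hA : ∀ p ∈ A, (p.2 : ℝ) ^ 2 ≤ (2 * m * p.1) ^ 2) :
    Summable fun p : A => coeff m τ w p.1.1 p.1.2 * g p.1.2 := by
  have h1 : 0 < (((1 / (16 * m ^ 2) : ℝ) : ℂ) * τ).im := by
    rw [Complex.im_ofReal_mul]; positivity
  have hs := (((summable_norm_e_quadratic (a := τ / 4) (by simpa using hτ) (τ / 2 + m * w)
    (τ / (16 * (m + 1 / 2)) + m * w / (4 * (m + 1 / 2)))).mul_of_nonneg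
    (summable_norm_e_quadratic h1 (-(w / 2)) 0)
    (fun _ => norm_nonneg _) (fun _ => norm_nonneg _)).mul_right C).subtype A
  refine Summable.of_norm_bounded hs fun p => ?_
  rw [norm_mul]
  exact mul_le_mul (norm_coeff_le hm hτ w (hA p p.2)) (hg _) (norm_nonneg _)
    (mul_nonneg (norm_nonneg _) (norm_nonneg _))

lemma mem_conePos {n : ℕ} {m : ℝ} (hm : m = n / 2) (p : ℤ × ℤ) :
    p ∈ conePos m ↔ p.2 ∈ Finset.Ioc 0 (n * p.1) := by
  rw [conePos, Set.mem_ofPred_eq, Finset.mem_Ioc, hm, mul_div_cancel₀ _ two_ne_zero]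
  norm_cast

lemma mem_coneNeg {n : ℕ} {m : ℝ} (hm : m = n / 2) (p : ℤ × ℤ) :
    p ∈ coneNeg m ↔ p.2 ∈ Finset.Ioc (n * p.1) 0 := by
  rw [coneNeg, Set.mem_ofPred_eq, Finset.mem_Ioc, hm, mul_div_cancel₀ _ two_ne_zero]
  norm_cast

lemma sq_le_of_mem_conePos {m : ℝ} {p : ℤ × ℤ} (hp : p ∈ conePos m) :
    (p.2 : ℝ) ^ 2 ≤ (2 * m * p.1) ^ 2 := by
  have h : (0 : ℝ) < p.2 := by exact_mod_cast hp.1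
  exact pow_le_pow_left₀ h.le hp.2 2

lemma sq_le_of_mem_coneNeg {m : ℝ} {p : ℤ × ℤ} (hp : p ∈ coneNeg m) :
    (p.2 : ℝ) ^ 2 ≤ (2 * m * p.1) ^ 2 := by
  have h : (p.2 : ℝ) ≤ 0 := by exact_mod_cast hp.2
  have := hp.1
  nlinarith

lemma hasSum_fiber {A : Set (ℤ × ℤ)} {s : ℤ → Finset ℤ} (hA : ∀ p, p ∈ A ↔ p.2 ∈ s p.1)
    {f : ℤ × ℤ → ℂ} (hf : Summable fun p : A => f p) :
    HasSum (fun j => ∑ k ∈ s j, f (j, k)) (∑' p : A, f p) := by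
  have h := (hasSum_subtype_iff_indicator.1 hf.hasSum).prod_fiberwise
    (g := fun j => ∑ k ∈ s j, f (j, k)) fun j => ?_
  · exact h
  · have h1 : ∀ k ∉ s j, A.indicator f (j, k) = 0 := fun k hk =>
      Set.indicator_of_notMem (fun h => hk ((hA _).1 h)) _
    have h2 : HasSum (fun k => A.indicator f (j, k)) _ := hasSum_sum_of_ne_finset_zero h1
    rwa [Finset.sum_congr rfl fun k hk =>
      Set.indicator_of_mem (s := A) ((hA (j, k)).2 hk) f] at h2

lemma hasSum_signedSum {n : ℕ} {m : ℝ} (hm : m = n / 2) {f : ℤ × ℤ → ℂ}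
    (hp : Summable fun p : conePos m => f p) (hn : Summable fun p : coneNeg m => f p) :
    HasSum (fun j : ℤ => signedSum (n * j) fun k => f (j, k))
      (diffSum (conePos m) (coneNeg m) f) :=
  (hasSum_fiber (mem_conePos hm) hp).sub (hasSum_fiber (mem_coneNeg hm) hn)

/-! ### The function Φ and formula (a) -/

lemma Phi1Term_eq (m : ℝ) (τ z₁ z₂ : ℂ) :
    Phi1Term 1 m 0 τ z₁ z₂ = appellTerm m τ (z₁ + z₂) z₁ := by
  ext l
  have h1 : Complex.exp (2 * Real.pi * Complex.I * m * l * (z₁ + z₂) +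
      2 * Real.pi * Complex.I * (0 : ℝ) * z₁) = e (m * l * (z₁ + z₂)) := by
    rw [e]; congr 1; push_cast; ring
  rw [Phi1Term, appellTerm, h1, ← e, qPow_eq_e, qPow_eq_e, Int.cast_one, one_zpow, one_mul,
    ← e_add, ← e_add, mul_comm τ l]
  simp

lemma Phi2Term_eq (m : ℝ) (τ z₁ z₂ : ℂ) :
    Phi2Term 1 m 0 τ z₁ z₂ = appellTerm m τ (-(z₁ + z₂)) (-z₂) := by
  ext l
  have h1 : Complex.exp (-(2 * Real.pi * Complex.I * m * l * (z₁ + z₂)) -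
      2 * Real.pi * Complex.I * (0 : ℝ) * z₂) = e (m * l * -(z₁ + z₂)) := by
    rw [e]; congr 1; push_cast; ring
  rw [Phi2Term, appellTerm, h1, ← mul_neg, ← e, qPow_eq_e, qPow_eq_e, Int.cast_one, one_zpow,
    one_mul, ← e_add, ← e_add, mul_comm τ l]
  simp

lemma PhiStar_eq (m : ℝ) (τ z₁ z₂ : ℂ) :
    PhiStar 1 m 0 τ z₁ z₂ 0 = ∑' l, appellTerm m τ (z₁ + z₂) z₁ l +
      ∑' l, appellTerm m τ (-(z₁ + z₂)) (-z₂) l := by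
  rw [PhiStar, Phi1, Phi2, Phi1Term_eq, Phi2Term_eq]
  simp

lemma summable_coeff_mul_thetaSgn {n : ℕ} (hn : 0 < n) {m : ℝ} (hm : m = n / 2) {τ : ℂ}
    (hτ : 0 < τ.im) (w Z : ℂ) {A : Set (ℤ × ℤ)}
    (hA : ∀ p ∈ A, (p.2 : ℝ) ^ 2 ≤ (2 * m * p.1) ^ 2) :
    Summable fun p : A => coeff m τ w p.1.1 p.1.2 * thetaSgn 1 p.1.2 m τ Z := by
  obtain ⟨C, hC⟩ := exists_norm_thetaSgn_le hn hm τ Z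
  exact summable_coeff_mul (by rw [hm]; positivity) hτ w (g := fun k : ℤ => thetaSgn 1 k m τ Z)
    hC hA

lemma summable_coeff_mul_thetaSgn_neg {n : ℕ} (hn : 0 < n) {m : ℝ} (hm : m = n / 2) {τ : ℂ}
    (hτ : 0 < τ.im) (w Z : ℂ) {A : Set (ℤ × ℤ)}
    (hA : ∀ p ∈ A, (p.2 : ℝ) ^ 2 ≤ (2 * m * p.1) ^ 2) :
    Summable fun p : A => coeff m τ w p.1.1 p.1.2 * thetaSgn 1 (-p.1.2) m τ Z := by
  have h := summable_coeff_mul_thetaSgn hn hm hτ w (-Z) hA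
  refine h.congr fun p => ?_
  rw [← thetaSgn_neg_neg (Or.inl rfl), neg_neg]

lemma doubleTerm_eq (m : ℝ) (τ z₁ z₂ : ℂ) (p : ℤ × ℤ) :
    doubleTerm m τ z₁ z₂ p = coeff m τ (z₁ - z₂) p.1 p.2 * thetaSgn 1 p.2 m τ (z₁ + z₂) +
      coeff m τ (z₁ - z₂) p.1 p.2 * thetaSgn 1 (-p.2) m τ (z₁ + z₂) := by
  rw [doubleTerm, thetaSymm, mul_add]

lemma summable_doubleTerm {n : ℕ} (hn : 0 < n) {m : ℝ} (hm : m = n / 2) {τ : ℂ}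
    (hτ : 0 < τ.im) (z₁ z₂ : ℂ) {A : Set (ℤ × ℤ)}
    (hA : ∀ p ∈ A, (p.2 : ℝ) ^ 2 ≤ (2 * m * p.1) ^ 2) :
    Summable fun p : A => doubleTerm m τ z₁ z₂ p := by
  simp only [doubleTerm_eq]
  exact (summable_coeff_mul_thetaSgn hn hm hτ _ _ hA).add
    (summable_coeff_mul_thetaSgn_neg hn hm hτ _ _ hA)

theorem thetaSgn_mul_PhiStar {n : ℕ} (hn : 0 < n) {m : ℝ} (hm : m = n / 2) {τ z₁ z₂ : ℂ}
    (hτ : 0 < τ.im) (hz₁ : ∀ a b : ℤ, z₁ ≠ a + b * τ) (hz₂ : ∀ a b : ℤ, z₂ ≠ a + b * τ) :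
    thetaSgn (-1) (1 / 2) (m + 1 / 2) τ (m * (z₁ - z₂) / (m + 1 / 2)) *
        PhiStar 1 m 0 τ z₁ z₂ 0 =
      -diffSum (conePos m) (coneNeg m) (doubleTerm m τ z₁ z₂) + etaTerm m τ z₁ z₂ := by
  have hz₂' : ∀ a b : ℤ, -z₂ ≠ a + b * τ := fun a b h =>
    hz₂ (-a) (-b) (by push_cast; linear_combination -h)
  have h1 := thetaSgn_mul_tsum_appellTerm hn hm (Z := z₁ + z₂) hτ hz₁
  have h2 := thetaSgn_mul_tsum_appellTerm hn hm (Z := -(z₁ + z₂)) hτ hz₂'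
  rw [show 2 * z₁ - (z₁ + z₂) = z₁ - z₂ by ring] at h1
  -- The second series has the same w = z₁ - z₂, hence the same coefficients; reflecting the theta
  -- functions turns -k into k and -1/2 into 1/2.
  rw [show 2 * -z₂ - -(z₁ + z₂) = z₁ - z₂ by ring, vartheta11_neg,
    show -(z₁ + z₂) + (z₁ - z₂) / (2 * (m : ℂ) + 1) =
      -(z₁ + z₂ - (z₁ - z₂) / (2 * (m : ℂ) + 1)) by ring,
    show (-1 / 2 : ℝ) = -(1 / 2) by norm_num, thetaSgn_neg_neg (Or.inr rfl)] at h2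
  simp only [thetaSgn_neg_neg (ε := 1) (Or.inl rfl)] at h2
  have hp := fun p => sq_le_of_mem_conePos (m := m) (p := p)
  have hq := fun p => sq_le_of_mem_coneNeg (m := m) (p := p)
  have s1 := hasSum_signedSum hm
    (f := fun p => coeff m τ (z₁ - z₂) p.1 p.2 * thetaSgn 1 p.2 m τ (z₁ + z₂))
    (summable_coeff_mul_thetaSgn hn hm hτ _ _ hp) (summable_coeff_mul_thetaSgn hn hm hτ _ _ hq)
  have s2 := hasSum_signedSum hm
    (f := fun p => coeff m τ (z₁ - z₂) p.1 p.2 * thetaSgn 1 (-p.2) m τ (z₁ + z₂))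
    (summable_coeff_mul_thetaSgn_neg hn hm hτ _ _ hp)
    (summable_coeff_mul_thetaSgn_neg hn hm hτ _ _ hq)
  have s3 := hasSum_signedSum hm (f := doubleTerm m τ z₁ z₂)
    (summable_doubleTerm hn hm hτ _ _ hp) (summable_doubleTerm hn hm hτ _ _ hq)
  have h3 : ∀ j : ℤ, (signedSum (n * j) fun k => doubleTerm m τ z₁ z₂ (j, k)) =
      (signedSum (n * j) fun k => coeff m τ (z₁ - z₂) j k * thetaSgn 1 k m τ (z₁ + z₂)) +
      signedSum (n * j) fun k => coeff m τ (z₁ - z₂) j k * thetaSgn 1 (-k) m τ (z₁ + z₂) :=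
    fun j => by
      simp only [signedSum, doubleTerm_eq, Finset.sum_add_distrib]
      ring
  simp only [h3] at s3
  have h4 := s3.unique (s1.add s2)
  rw [h4, ← s1.tsum_eq, ← s2.tsum_eq, PhiStar_eq, mul_add, h1, h2, etaTerm, div_neg]
  ring

/-! ### Regrouping by residues modulo 2m -/

lemma floor_half_add_ceil_half (n : ℕ) : ⌊(n / 2 : ℝ)⌋ + ⌈(n / 2 : ℝ)⌉ = n ∧
    2 * ⌊(n / 2 : ℝ)⌋ ≤ n ∧ (n : ℤ) < 2 * ⌊(n / 2 : ℝ)⌋ + 2 := by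
  have h1 := Int.floor_le (n / 2 : ℝ)
  have h2 := Int.lt_floor_add_one (n / 2 : ℝ)
  have h3 := Int.le_ceil (n / 2 : ℝ)
  have h4 := Int.ceil_lt_add_one (n / 2 : ℝ)
  have g1 : 2 * ⌊(n / 2 : ℝ)⌋ ≤ n := by
    exact_mod_cast (show 2 * (⌊(n / 2 : ℝ)⌋ : ℝ) ≤ n by linarith)
  have g2 : (n : ℤ) < 2 * ⌊(n / 2 : ℝ)⌋ + 2 := by
    exact_mod_cast (show (n : ℝ) < 2 * (⌊(n / 2 : ℝ)⌋ : ℝ) + 2 by linarith)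
  have g3 : (n : ℤ) ≤ 2 * ⌈(n / 2 : ℝ)⌉ := by
    exact_mod_cast (show (n : ℝ) ≤ 2 * (⌈(n / 2 : ℝ)⌉ : ℝ) by linarith)
  have g4 : 2 * ⌈(n / 2 : ℝ)⌉ < (n : ℤ) + 2 := by
    exact_mod_cast (show 2 * (⌈(n / 2 : ℝ)⌉ : ℝ) < n + 2 by linarith)
  exact ⟨by lia, g1, g2⟩

/-- The half-open interval holds exactly n consecutive integers. With a = ⌊m⌋ and b = ⌈m⌉ it yields
0 ≤ s ≤ m for -s and 0 < s < m for +s, for m integral or not. -/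
lemma bijective_residues {n : ℕ} (hn : 0 < n) {a b : ℤ} (hab : a + b = n) :
    Function.Bijective fun x : (ℤ × ℤ) × Finset.Ico (-a) b =>
      ((x.1.1, n * x.1.2 + (x.2 : ℤ)) : ℤ × ℤ) := by
  have hn' : (0 : ℤ) < n := by exact_mod_cast hn
  constructor
  · rintro ⟨⟨j, r⟩, s, hs⟩ ⟨⟨j', r'⟩, s', hs'⟩ h
    simp only [Prod.mk.injEq] at h
    rw [Finset.mem_Ico] at hs hs'
    obtain ⟨rfl, h⟩ := h
    have hr : r = r' := by
      rcases lt_trichotomy r r' with hlt | rfl | hlt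
      · nlinarith
      · rfl
      · nlinarith
    subst hr
    have : s = s' := by linarith
    subst this
    rfl
  · rintro ⟨j, k⟩
    have h1 := Int.emod_nonneg (k + a) hn'.ne'
    have h2 := Int.emod_lt_of_pos (k + a) hn'
    have h3 := Int.mul_ediv_add_emod (k + a) n
    exact ⟨((j, (k + a) / n), ⟨(k + a) % n - a, Finset.mem_Ico.2 ⟨by lia, by lia⟩⟩),
      Prod.ext rfl (by simp only; lia)⟩

lemma sum_Ico_neg_split {a b : ℤ} (ha : 0 ≤ a) (hb : 0 < b) (g : ℤ → ℂ) :
    ∑ s ∈ Finset.Ico (-a) b, g s =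
      ∑ s ∈ Finset.Icc 0 a, g (-s) + ∑ s ∈ Finset.Ioo 0 b, g s := by
  have h1 : Finset.Ico (-a) b = Finset.Icc (-a) 0 ∪ Finset.Ioo 0 b := by
    ext x; simp only [Finset.mem_Ico, Finset.mem_union, Finset.mem_Icc, Finset.mem_Ioo]; lia
  rw [h1, Finset.sum_union]
  · congr 1
    refine Finset.sum_nbij' (fun x => -x) (fun x => -x) ?_ ?_ ?_ ?_ ?_ <;> intro x <;> simp <;> lia
  · rw [Finset.disjoint_left]
    intro x; simp only [Finset.mem_Icc, Finset.mem_Ioo]; lia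

lemma doubleTerm_sub {n : ℕ} (hn : 0 < n) {m : ℝ} (hm : m = n / 2) (τ z₁ z₂ : ℂ) (j r s : ℤ) :
    doubleTerm m τ z₁ z₂ (j, n * r + -s) =
      coeff m τ (z₁ - z₂) j (2 * m * r - s) * thetaSymm s m τ (z₁ + z₂) := by
  have h : ((n * r + -s : ℤ) : ℝ) = 2 * m * r + -s := by rw [hm]; push_cast; ring
  rw [doubleTerm]
  simp only
  rw [h, thetaSymm_add_period (by rw [hm]; positivity), thetaSymm_neg, sub_eq_add_neg (2 * m * _)]

lemma doubleTerm_add {n : ℕ} (hn : 0 < n) {m : ℝ} (hm : m = n / 2) (τ z₁ z₂ : ℂ) (j r s : ℤ) :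
    doubleTerm m τ z₁ z₂ (j, n * r + s) =
      coeff m τ (z₁ - z₂) j (2 * m * r + s) * thetaSymm s m τ (z₁ + z₂) := by
  have h : ((n * r + s : ℤ) : ℝ) = 2 * m * r + s := by rw [hm]; push_cast; ring
  rw [doubleTerm]
  simp only
  rw [h, thetaSymm_add_period (by rw [hm]; positivity)]

/-- Regrouping a sum over `(j, k)` by the residue of `k`. -/
lemma regroup_residues {n : ℕ} (hn : 0 < n) {m : ℝ} (hm : m = n / 2) {τ z₁ z₂ : ℂ}
    {C A B : Set (ℤ × ℤ)} (hC : Summable fun p : C => doubleTerm m τ z₁ z₂ p)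
    (hA : ∀ s j r : ℤ, 0 ≤ s → s < n → ((j, n * r + -s) ∈ C ↔ (j, r) ∈ A))
    (hB : ∀ s j r : ℤ, 0 < s → s < n → ((j, n * r + s) ∈ C ↔ (j, r) ∈ B)) :
    (Summable fun p : A => closedTerm m τ z₁ z₂ p) ∧
      (Summable fun p : B => openTerm m τ z₁ z₂ p) ∧
      ∑' p : C, doubleTerm m τ z₁ z₂ p =
        ∑' p : A, closedTerm m τ z₁ z₂ p + ∑' p : B, openTerm m τ z₁ z₂ p := by
  classical
  have hn' : (0 : ℤ) < n := by exact_mod_cast hn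
  obtain ⟨hab, ha1, ha2⟩ := floor_half_add_ceil_half n
  rw [← hm] at hab ha1 ha2
  -- Extending by zero lets the residue bijection act on all of ℤ × ℤ.
  obtain ⟨F, hF⟩ : ∃ F, F = C.indicator (doubleTerm m τ z₁ z₂) := ⟨_, rfl⟩
  have hFs : Summable F := hF ▸ summable_subtype_iff_indicator.1 hC
  have hcl : ∀ p : ℤ × ℤ, A.indicator (closedTerm m τ z₁ z₂) p =
      ∑ s ∈ Finset.Icc 0 ⌊m⌋, F (p.1, n * p.2 + -s) := by
    rintro ⟨j, r⟩
    by_cases hp : (j, r) ∈ A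
    · rw [Set.indicator_of_mem hp, closedTerm]
      refine Finset.sum_congr rfl fun s hs => ?_
      rw [Finset.mem_Icc] at hs
      rw [hF, Set.indicator_of_mem ((hA s j r hs.1 (by lia)).2 hp), doubleTerm_sub hn hm]
    · rw [Set.indicator_of_notMem hp]
      refine (Finset.sum_eq_zero fun s hs => ?_).symm
      rw [Finset.mem_Icc] at hs
      rw [hF]
      exact Set.indicator_of_notMem (fun h => hp ((hA s j r hs.1 (by lia)).1 h)) _
  have hop : ∀ p : ℤ × ℤ, B.indicator (openTerm m τ z₁ z₂) p =
      ∑ s ∈ Finset.Ioo 0 ⌈m⌉, F (p.1, n * p.2 + s) := by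
    rintro ⟨j, r⟩
    by_cases hp : (j, r) ∈ B
    · rw [Set.indicator_of_mem hp, openTerm]
      refine Finset.sum_congr rfl fun s hs => ?_
      rw [Finset.mem_Ioo] at hs
      rw [hF, Set.indicator_of_mem ((hB s j r hs.1 (by lia)).2 hp), doubleTerm_add hn hm]
    · rw [Set.indicator_of_notMem hp]
      refine (Finset.sum_eq_zero fun s hs => ?_).symm
      rw [Finset.mem_Ioo] at hs
      rw [hF]
      exact Set.indicator_of_notMem (fun h => hp ((hB s j r hs.1 (by lia)).1 h)) _
  have hshift : ∀ s : ℤ, Summable fun p : ℤ × ℤ => F (p.1, n * p.2 + s) := fun s =>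
    hFs.comp_injective (i := fun p : ℤ × ℤ => (p.1, n * p.2 + s)) fun p q h => by
      simp only [Prod.mk.injEq, add_left_inj, mul_eq_mul_left_iff, hn'.ne', or_false] at h
      exact Prod.ext h.1 h.2
  have hclS : Summable (A.indicator (closedTerm m τ z₁ z₂)) :=
    (summable_sum fun s _ => hshift (-s)).congr fun p => (hcl p).symm
  have hopS : Summable (B.indicator (openTerm m τ z₁ z₂)) :=
    (summable_sum fun s _ => hshift s).congr fun p => (hop p).symm
  have hA' : Summable (closedTerm m τ z₁ z₂ ∘ ((↑) : A → ℤ × ℤ)) :=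
    summable_subtype_iff_indicator.2 hclS
  have hB' : Summable (openTerm m τ z₁ z₂ ∘ ((↑) : B → ℤ × ℤ)) :=
    summable_subtype_iff_indicator.2 hopS
  refine ⟨hA', hB', ?_⟩
  rw [tsum_subtype, tsum_subtype, tsum_subtype, ← hF, ← hclS.tsum_add hopS]
  have hbij := bijective_residues hn hab
  have hs2 : Summable fun x : (ℤ × ℤ) × Finset.Ico (-⌊m⌋) ⌈m⌉ =>
      F (x.1.1, n * x.1.2 + (x.2 : ℤ)) := hFs.comp_injective hbij.injective
  have ht : ∑' x : (ℤ × ℤ) × Finset.Ico (-⌊m⌋) ⌈m⌉, F (x.1.1, n * x.1.2 + (x.2 : ℤ)) =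
      ∑' p, F p := (Equiv.ofBijective _ hbij).tsum_eq F
  rw [← ht, hs2.tsum_prod]
  refine tsum_congr fun p => ?_
  rw [hcl, hop, ← sum_Ico_neg_split (g := fun s => F (p.1, n * p.2 + s)) (by lia) (by lia),
    tsum_fintype]
  exact Finset.sum_coe_sort (Finset.Ico (-⌊m⌋) ⌈m⌉) fun s => F (p.1, n * p.2 + s)

lemma mul_sub_pos_iff {n s : ℤ} (hs0 : 0 ≤ s) (hs : s < n) (x : ℤ) : 0 < n * x - s ↔ 0 < x := by
  constructor
  · intro h; by_contra! hx; nlinarith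
  · intro h; nlinarith

lemma mul_add_pos_iff {n s : ℤ} (hs0 : 0 < s) (hs : s < n) (x : ℤ) : 0 < n * x + s ↔ 0 ≤ x := by
  constructor
  · intro h; by_contra! hx; nlinarith
  · intro h; nlinarith

end MockTheta

end


open MockTheta
theorem propositionm1 (m : ℝ) (hm : ∃ n : ℕ, 0 < n ∧ m = (n : ℝ) / 2)
    (τ z₁ z₂ : ℂ) (hτ : 0 < τ.im)
    (hz₁ : ∀ a b : ℤ, z₁ ≠ a + b * τ) (hz₂ : ∀ a b : ℤ, z₂ ≠ a + b * τ) :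
    -- the series of `Φ₁`, `Φ₂` converge and the denominators do not vanish
    (Summable (Phi1Term 1 m 0 τ z₁ z₂) ∧ Summable (Phi2Term 1 m 0 τ z₁ z₂) ∧
      vartheta11 τ z₁ ≠ 0 ∧ vartheta11 τ z₂ ≠ 0) ∧
    -- the double sum over `(j, k)`
    ((Summable fun p : conePos m => doubleTerm m τ z₁ z₂ p) ∧
      (Summable fun p : coneNeg m => doubleTerm m τ z₁ z₂ p) ∧
      thetaSgn (-1) (1 / 2) (m + 1 / 2) τ (m * (z₁ - z₂) / (m + 1 / 2)) *
          PhiStar 1 m 0 τ z₁ z₂ 0 =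
        -diffSum (conePos m) (coneNeg m) (doubleTerm m τ z₁ z₂) + etaTerm m τ z₁ z₂) ∧
    -- the regrouping by residues, with sums over `(j, r)`
    ((Summable fun p : {p : ℤ × ℤ | 0 < p.2 ∧ p.2 ≤ p.1} => closedTerm m τ z₁ z₂ p) ∧
      (Summable fun p : {p : ℤ × ℤ | p.1 < p.2 ∧ p.2 ≤ 0} => closedTerm m τ z₁ z₂ p) ∧
      (Summable fun p : {p : ℤ × ℤ | 0 ≤ p.2 ∧ p.2 < p.1} => openTerm m τ z₁ z₂ p) ∧
      (Summable fun p : {p : ℤ × ℤ | p.1 ≤ p.2 ∧ p.2 < 0} => openTerm m τ z₁ z₂ p) ∧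
      thetaSgn (-1) (1 / 2) (m + 1 / 2) τ (m * (z₁ - z₂) / (m + 1 / 2)) *
          PhiStar 1 m 0 τ z₁ z₂ 0 =
        etaTerm m τ z₁ z₂ -
          diffSum {p | 0 < p.2 ∧ p.2 ≤ p.1} {p | p.1 < p.2 ∧ p.2 ≤ 0}
            (closedTerm m τ z₁ z₂) -
          diffSum {p | 0 ≤ p.2 ∧ p.2 < p.1} {p | p.1 ≤ p.2 ∧ p.2 < 0}
            (openTerm m τ z₁ z₂)) := by
  obtain ⟨n, hn, hm⟩ := hm
  have hm0 : 0 < m := by rw [hm]; positivity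
  have hpos := summable_doubleTerm hn hm hτ z₁ z₂ fun p => sq_le_of_mem_conePos (m := m) (p := p)
  have hneg := summable_doubleTerm hn hm hτ z₁ z₂ fun p => sq_le_of_mem_coneNeg (m := m) (p := p)
  have hmain := thetaSgn_mul_PhiStar hn hm hτ hz₁ hz₂
  obtain ⟨p1, p2, p3⟩ := regroup_residues hn hm
    (A := {p : ℤ × ℤ | 0 < p.2 ∧ p.2 ≤ p.1}) (B := {p : ℤ × ℤ | 0 ≤ p.2 ∧ p.2 < p.1}) hpos
    -- The bounds 0 < k and k ≤ nj are tests on the signs of nr ∓ s and n(r-j) ∓ s, and 0 ≤ s < n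
    -- makes these independent of s apart from strictness.
    (fun s j r hs0 hs => by
      have h1 := mul_sub_pos_iff hs0 hs r
      have h2 := mul_sub_pos_iff hs0 hs (r - j)
      rw [mul_sub] at h2
      rw [mem_conePos hm, Finset.mem_Ioc, Set.mem_ofPred_eq]
      lia)
    (fun s j r hs0 hs => by
      have h1 := mul_add_pos_iff hs0 hs r
      have h2 := mul_add_pos_iff hs0 hs (r - j)
      rw [mul_sub] at h2
      rw [mem_conePos hm, Finset.mem_Ioc, Set.mem_ofPred_eq]
      lia)
  obtain ⟨n1, n2, n3⟩ := regroup_residues hn hm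
    (A := {p : ℤ × ℤ | p.1 < p.2 ∧ p.2 ≤ 0}) (B := {p : ℤ × ℤ | p.1 ≤ p.2 ∧ p.2 < 0}) hneg
    (fun s j r hs0 hs => by
      have h1 := mul_sub_pos_iff hs0 hs r
      have h2 := mul_sub_pos_iff hs0 hs (r - j)
      rw [mul_sub] at h2
      rw [mem_coneNeg hm, Finset.mem_Ioc, Set.mem_ofPred_eq]
      lia)
    (fun s j r hs0 hs => by
      have h1 := mul_add_pos_iff hs0 hs r
      have h2 := mul_add_pos_iff hs0 hs (r - j)
      rw [mul_sub] at h2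
      rw [mem_coneNeg hm, Finset.mem_Ioc, Set.mem_ofPred_eq]
      lia)
  refine ⟨⟨?_, ?_, vartheta11_ne_zero hτ hz₁, vartheta11_ne_zero hτ hz₂⟩,
    ⟨hpos, hneg, hmain⟩, p1, n1, p2, n2, ?_⟩
  · rw [Phi1Term_eq]; exact (summable_appellTerm hm0 hτ _ _).of_norm
  · rw [Phi2Term_eq]; exact (summable_appellTerm hm0 hτ _ _).of_norm
  · rw [hmain, diffSum, diffSum, diffSum, p3, n3]
    ring
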